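/- For a group $G$ let $G_1=G$, $G_{m+1}=[G_m,G]$ be its descending central series, and let $\mathrm{gr}_*(G)=\bigoplus_{m\ge 1}G_m/G_{m+1}$ be the associated Lie algebra over $\mathbb Z$, whose bracket is induced by the commutator $[x,y]=xyx^{-1}y^{-1}$. **Proposition 2.1.** Let $n\ge 0$ and let $\Gamma_0,\Gamma_1,\dots,\Gamma_n$ be groups such that $\Gamma_0=F_{\alpha(0)}$ is a free group on a set $\alpha(0)$ and, for every $1\le k\le n$, there is an extension $$1\longrightarrow F_{\alpha(k)}\longrightarrow \Gamma_k\stackrel{p_k}{\longrightarrow}\Gamma_{k-1}\longrightarrow 1$$ in which $F_{\alpha(k)}$ is a free group on a countable set $\alpha(k)$ of cardinality at least two, $p_k$ is a split epimorphism, and the action of $\Gamma_{k-1}$ on the integral homology $H_*(F_{\alpha(k)};\mathbb Z)$ (induced by conjugation in $\Gamma_k$) is trivial. Then the center of the Lie algebra $\mathrm{gr}_*(\Gamma_n)$ is cyclic (possibly trivial) as an abelian group. If, furthermore, $F_{\alpha(k)}$ has rank at least two for every $0\le k\le n$, then both the center of $\mathrm{gr}_*(\Gamma_n)$ and the center of the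 group $\Gamma_n$ are trivial. -/

import Mathlib

universe u v

/-! ### The Lie ring of the descending central series -/

namespace DescendingCentralSeries

open scoped DirectSum commutatorElement

variable {G : Type u} [Group G]

variable (G) in
/-- The stage `G_{n+1}` of the descending central series, where `G_1 = G`: `lcs G 0 = G` and
`lcs G (n+1) = [lcs G n, G]`. -/
abbrev lcs (n : ℕ) : Subgroup G := (⊤ : Subgroup G).lowerCentralSeries n

theorem commutator_commutator_le_of_rotate (A B C N : Subgroup G) [N.Normal]
    (h1 : ⁅⁅B, C⁆, A⁆ ≤ N) (h2 : ⁅⁅C, A⁆, B⁆ ≤ N) : ⁅⁅A, B⁆, C⁆ ≤ N := by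
  have key : ∀ K : Subgroup G, K ≤ N ↔ K.map (QuotientGroup.mk' N) = ⊥ := by
    intro K
    rw [Subgroup.map_eq_bot_iff, QuotientGroup.ker_mk']
  rw [key] at h1 h2 ⊢
  simp only [Subgroup.map_commutator] at h1 h2 ⊢
  exact Subgroup.commutator_commutator_eq_bot_of_rotate h1 h2

theorem commutator_lcs_le (m n : ℕ) : ⁅lcs G m, lcs G n⁆ ≤ lcs G (m + n + 1) := by
  induction n generalizing m with
  | zero => exact le_of_eq rfl
  | succ n ih =>
    rw [Subgroup.commutator_comm]
    change ⁅⁅lcs G n, ⊤⁆, lcs G m⁆ ≤ _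
    apply commutator_commutator_le_of_rotate
    · rw [Subgroup.commutator_comm ⊤ (lcs G m)]
      have h := ih (m + 1)
      rwa [show m + 1 + n + 1 = m + (n + 1) + 1 by ring] at h
    · exact Subgroup.commutator_mono (ih m) le_rfl

theorem commutator_mem_lcs {i j : ℕ} {x y : G} (hx : x ∈ lcs G i) (hy : y ∈ lcs G j) :
    ⁅x, y⁆ ∈ lcs G (i + j + 1) :=
  commutator_lcs_le i j (Subgroup.commutator_mem_commutator hx hy)

theorem lcs_le {i j : ℕ} (h : i ≤ j) : lcs G j ≤ lcs G i :=
  (⊤ : Subgroup G).lowerCentralSeries_antitone h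

variable (G) in
/-- The quotient `G_{i+1} / G_{i+2}`, written multiplicatively. -/
abbrev GrMul (i : ℕ) : Type u := lcs G i ⧸ (lcs G (i + 1)).subgroupOf (lcs G i)

instance instCommGroupGrMul (i : ℕ) : CommGroup (GrMul G i) :=
  { (inferInstance : Group (GrMul G i)) with
    mul_comm := by
      intro a b
      induction a using QuotientGroup.induction_on with | _ a
      induction b using QuotientGroup.induction_on with | _ b
      change ((a * b : lcs G i) : GrMul G i) = ((b * a : lcs G i) : GrMul G i)
      rw [QuotientGroup.eq, Subgroup.mem_subgroupOf]
      have h : (((a * b)⁻¹ * (b * a) : lcs G i) : G) = ⁅((b⁻¹ : lcs G i) : G), ((a⁻¹ : lcs G i) : G)⁆ := by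
        simp only [commutatorElement_def, Subgroup.coe_mul, Subgroup.coe_inv]
        group
      rw [h]
      exact lcs_le (by omega) (commutator_mem_lcs (b⁻¹).2 (a⁻¹).2) }

variable (G) in
/-- `gr_{i+1}(G) = G_{i+1} / G_{i+2}`, written additively. -/
abbrev GrPiece (i : ℕ) : Type u := Additive (GrMul G i)

/-- The class in `G_{i+1} / G_{i+2}` of an element of `G_{i+1}`. -/
def mkMul (i : ℕ) (x : lcs G i) : GrMul G i := QuotientGroup.mk x

theorem mkMul_mul (i : ℕ) (x y : lcs G i) : mkMul i (x * y) = mkMul i x * mkMul i y := rfl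

theorem mkMul_eq_iff (i : ℕ) (x y : lcs G i) :
    mkMul i x = mkMul i y ↔ (x : G)⁻¹ * (y : G) ∈ lcs G (i + 1) := by
  unfold mkMul
  rw [QuotientGroup.eq, Subgroup.mem_subgroupOf]
  rfl

/-- The commutator `[x, y] = x y x⁻¹ y⁻¹` as an element of `G_{(i+1)+(j+1)}`. -/
def comm {i j : ℕ} (x : lcs G i) (y : lcs G j) : lcs G (i + j + 1) :=
  ⟨⁅(x : G), (y : G)⁆, commutator_mem_lcs x.2 y.2⟩

theorem mkMul_comm_mul_left {i j : ℕ} (x x' : lcs G i) (y : lcs G j) :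
    mkMul _ (comm (x * x') y) = mkMul _ (comm x y) * mkMul _ (comm x' y) := by
  rw [mul_comm, ← mkMul_mul, mkMul_eq_iff]
  have h : ((comm (x * x') y : lcs G (i + j + 1)) : G)⁻¹ *
      ((comm x' y * comm x y : lcs G (i + j + 1)) : G) =
      ((comm x' y * comm x y : lcs G (i + j + 1)) : G)⁻¹ *
        ⁅(x : G), ((comm x' y : lcs G _) : G)⁆⁻¹ *
          (((comm x' y * comm x y : lcs G (i + j + 1)) : G)⁻¹)⁻¹ := by
    simp only [comm, commutatorElement_def, Subgroup.coe_mul]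
    group
  rw [h]
  exact Subgroup.Normal.conj_mem inferInstance _
    (inv_mem (lcs_le (by omega) (commutator_mem_lcs x.2 (comm x' y).2))) _

theorem mkMul_comm_swap_inv {i j : ℕ} (x : lcs G i) (y : lcs G j) :
    ((comm x y : lcs G _) : G) = ((comm y x : lcs G _) : G)⁻¹ := by
  simp only [comm, commutatorElement_inv]

theorem mkMul_comm_mul_right {i j : ℕ} (x : lcs G i) (y y' : lcs G j) :
    mkMul _ (comm x (y * y')) = mkMul _ (comm x y) * mkMul _ (comm x y') := by
  rw [← mkMul_mul, mkMul_eq_iff]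
  have h : ((comm x (y * y') : lcs G (i + j + 1)) : G)⁻¹ *
      ((comm x y * comm x y' : lcs G (i + j + 1)) : G) =
      ⁅(y : G), ((comm x y' : lcs G (i + j + 1)) : G)⁻¹⁆ := by
    simp only [comm, commutatorElement_def, Subgroup.coe_mul]
    group
  rw [h]
  exact lcs_le (by omega) (commutator_mem_lcs y.2 (inv_mem (comm x y').2))

theorem mkMul_comm_eq_one_left {i j : ℕ} (x : lcs G i) (y : lcs G j)
    (hx : (x : G) ∈ lcs G (i + 1)) : mkMul _ (comm x y) = 1 := by
  change _ = mkMul _ 1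
  rw [eq_comm, mkMul_eq_iff]
  simp only [Subgroup.coe_one, inv_one, one_mul, comm]
  exact lcs_le (by omega) (commutator_mem_lcs hx y.2)

theorem mkMul_comm_eq_one_right {i j : ℕ} (x : lcs G i) (y : lcs G j)
    (hy : (y : G) ∈ lcs G (j + 1)) : mkMul _ (comm x y) = 1 := by
  change _ = mkMul _ 1
  rw [eq_comm, mkMul_eq_iff]
  simp only [Subgroup.coe_one, inv_one, one_mul, comm]
  exact lcs_le (by omega) (commutator_mem_lcs x.2 hy)

/-- The pairing `gr_{i+1}(G) × gr_{j+1}(G) → gr_{(i+1)+(j+1)}(G)` induced by the commutator map,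
in multiplicative notation. -/
def pairingMul (i j : ℕ) : GrMul G i →* GrMul G j →* GrMul G (i + j + 1) :=
  QuotientGroup.lift _
    { toFun := fun x => QuotientGroup.lift _
        { toFun := fun y => mkMul _ (comm x y)
          map_one' := mkMul_comm_eq_one_right _ _ (one_mem _)
          map_mul' := mkMul_comm_mul_right x }
        (fun y hy => mkMul_comm_eq_one_right x y hy)
      map_one' := by
        ext y
        exact mkMul_comm_eq_one_left _ _ (one_mem _)
      map_mul' := fun x x' => by
        ext y
        exact mkMul_comm_mul_left x x' y }
    (fun x hx => by
      ext y
      exact mkMul_comm_eq_one_left x y hx)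

/-- The bilinear pairing `gr_{i+1}(G) × gr_{j+1}(G) → gr_{(i+1)+(j+1)}(G)` sending the classes of
`x` and `y` to the class of `x y x⁻¹ y⁻¹`. -/
def pairing (i j : ℕ) : GrPiece G i →+ GrPiece G j →+ GrPiece G (i + j + 1) :=
  AddMonoidHom.mk' (fun a => (pairingMul i j a.toMul).toAdditive) (by
    intro a b
    ext y
    exact congrArg Additive.ofMul
      (DFunLike.congr_fun (map_mul (pairingMul i j) a.toMul b.toMul) (QuotientGroup.mk y)))

/-- The class in `gr_{i+1}(G)` of an element of `G_{i+1}`. -/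
def mk (i : ℕ) (x : lcs G i) : GrPiece G i := Additive.ofMul (mkMul i x)

theorem pairing_mk (i j : ℕ) (x : lcs G i) (y : lcs G j) :
    pairing i j (mk i x) (mk j y) = mk (i + j + 1) (comm x y) := rfl

variable (G) in
/-- `gr_*(G) = ⨁_{n ≥ 1} G_n / G_{n+1}`; the summand of index `i` is the one of degree `i + 1`. -/
def Gr : Type u := ⨁ i : ℕ, GrPiece G i

noncomputable instance instAddCommGroupGr : AddCommGroup (Gr G) :=
  inferInstanceAs (AddCommGroup (⨁ i : ℕ, GrPiece G i))

/-- The inclusion of the homogeneous part of degree `i + 1`. -/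
noncomputable def of (i : ℕ) : GrPiece G i →+ Gr G := DirectSum.of (GrPiece G) i

variable (G) in
/-- The biadditive extension of the pairings to the direct sum. -/
noncomputable def sumBracket :
    (⨁ i : ℕ, GrPiece G i) →+ (⨁ i : ℕ, GrPiece G i) →+ (⨁ i : ℕ, GrPiece G i) :=
  DirectSum.toAddMonoid fun i => AddMonoidHom.flip <|
    DirectSum.toAddMonoid fun j => AddMonoidHom.flip <|
      (DirectSum.of (GrPiece G) (i + j + 1)).compHom.comp (pairing i j)

theorem sumBracket_of_of (i j : ℕ) (a : GrPiece G i) (b : GrPiece G j) :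
    sumBracket G (DirectSum.of (GrPiece G) i a) (DirectSum.of (GrPiece G) j b) =
      DirectSum.of (GrPiece G) (i + j + 1) (pairing i j a b) := by
  unfold sumBracket
  rw [DirectSum.toAddMonoid_of, AddMonoidHom.flip_apply, DirectSum.toAddMonoid_of,
    AddMonoidHom.flip_apply]
  rfl

/-- The bracket of `gr_*(G)` as a biadditive map. -/
noncomputable def bracketHom : Gr G →+ Gr G →+ Gr G := sumBracket G

noncomputable instance instBracketGr : Bracket (Gr G) (Gr G) := ⟨fun a b => bracketHom a b⟩

theorem bracket_def (a b : Gr G) : ⁅a, b⁆ = bracketHom a b := rfl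

theorem bracketHom_of_of (i j : ℕ) (a : GrPiece G i) (b : GrPiece G j) :
    bracketHom (of i a) (of j b) = of (i + j + 1) (pairing i j a b) :=
  sumBracket_of_of i j a b

theorem bracketHom_mk_mk (i j : ℕ) (x : lcs G i) (y : lcs G j) :
    bracketHom (of i (mk i x)) (of j (mk j y)) = of (i + j + 1) (mk (i + j + 1) (comm x y)) := by
  rw [bracketHom_of_of, pairing_mk]

theorem gr_induction {P : Gr G → Prop} (a : Gr G) (h0 : P 0)
    (hof : ∀ i (x : lcs G i), P (of i (mk i x))) (hadd : ∀ a b, P a → P b → P (a + b)) : P a := by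
  refine DirectSum.induction_on (motive := P) a h0 (fun i x => ?_) hadd
  induction x using Additive.rec with | _ x
  induction x using QuotientGroup.induction_on with | _ x
  exact hof i x

/-- Classes of elements that agree modulo the next stage agree, whatever the index is called. -/
theorem of_mk_congr {i j : ℕ} (h : i = j) (x : lcs G i) (y : lcs G j)
    (hxy : (x : G)⁻¹ * (y : G) ∈ lcs G (i + 1)) : of i (mk i x) = of j (mk j y) := by
  subst h
  exact congrArg (fun t => of i (Additive.ofMul t)) ((mkMul_eq_iff i x y).2 hxy)

theorem of_mk_mul (i : ℕ) (x y : lcs G i) :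
    of i (mk i (x * y)) = of i (mk i x) + of i (mk i y) := by
  rw [← map_add]; rfl

theorem of_mk_one (i : ℕ) : of i (mk i (1 : lcs G i)) = 0 := map_zero (of (G := G) i)

theorem bracketHom_swap (a b : Gr G) : bracketHom a b + bracketHom b a = 0 := by
  induction a using gr_induction with
  | h0 => simp
  | hadd a a' ha ha' =>
    simp only [map_add, AddMonoidHom.add_apply]
    rw [add_add_add_comm, ha, ha', add_zero]
  | hof i x =>
    induction b using gr_induction with
    | h0 => simp
    | hadd b b' hb hb' =>
      simp only [map_add, AddMonoidHom.add_apply]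
      rw [add_add_add_comm, hb, hb', add_zero]
    | hof j y =>
      rw [bracketHom_mk_mk, bracketHom_mk_mk]
      have hmem : ((comm y x : lcs G (j + i + 1)) : G) ∈ lcs G (i + j + 1) :=
        lcs_le (by omega) (comm y x).2
      rw [of_mk_congr (show j + i + 1 = i + j + 1 by ring) (comm y x) ⟨_, hmem⟩ (by rw [inv_mul_cancel]; exact one_mem _),
        ← of_mk_mul, ← of_mk_one (i + j + 1)]
      congr 2
      ext
      simp only [Subgroup.coe_mul, mkMul_comm_swap_inv x y, inv_mul_cancel, Subgroup.coe_one]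

theorem bracketHom_self (a : Gr G) : bracketHom a a = 0 := by
  induction a using gr_induction with
  | h0 => simp
  | hadd a b ha hb =>
    simp only [map_add, AddMonoidHom.add_apply]
    rw [ha, hb, zero_add, add_zero, add_comm, bracketHom_swap]
  | hof i x =>
    rw [bracketHom_mk_mk, ← of_mk_one (i + i + 1)]
    congr 2
    ext
    simp [comm]

/-- The Hall–Witt identity. -/
theorem hall_witt (x y z : G) :
    ⁅⁅x, y⁆, y * z * y⁻¹⁆ * ⁅⁅y, z⁆, z * x * z⁻¹⁆ * ⁅⁅z, x⁆, x * y * x⁻¹⁆ = 1 := by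
  simp only [commutatorElement_def]
  group

theorem bracketHom_conj {i j k : ℕ} (w : lcs G i) (y : lcs G j) (z z' : lcs G k)
    (hz : (z' : G) = y * z * (y : G)⁻¹) :
    bracketHom (of i (mk i w)) (of k (mk k z)) = bracketHom (of i (mk i w)) (of k (mk k z')) := by
  congr 1
  apply of_mk_congr rfl
  have h : (z : G)⁻¹ * (z' : G) = ⁅(z : G)⁻¹, (y : G)⁆ := by
    rw [hz, commutatorElement_def]; group
  rw [h]
  exact lcs_le (by omega) (commutator_mem_lcs (inv_mem z.2) y.2)

theorem jacobi_cyclic (a b c : Gr G) :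
    bracketHom (bracketHom a b) c + bracketHom (bracketHom b c) a
      + bracketHom (bracketHom c a) b = 0 := by
  have hassoc : ∀ p q r p' q' r' : Gr G, (p + p') + (q + q') + (r + r') =
      (p + q + r) + (p' + q' + r') := by intros; abel
  induction a using gr_induction with
  | h0 => simp
  | hadd a a' ha ha' =>
    simp only [map_add, AddMonoidHom.add_apply]
    rw [hassoc, ha, ha', add_zero]
  | hof i x =>
    induction b using gr_induction with
    | h0 => simp
    | hadd b b' hb hb' =>
      simp only [map_add, AddMonoidHom.add_apply]
      rw [hassoc, hb, hb', add_zero]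
    | hof j y =>
      induction c using gr_induction with
      | h0 => simp
      | hadd c c' hc hc' =>
        simp only [map_add, AddMonoidHom.add_apply]
        rw [hassoc, hc, hc', add_zero]
      | hof k z =>
        have hn : ∀ (l : ℕ) (s t : G), s ∈ lcs G l → t * s * t⁻¹ ∈ lcs G l :=
          fun l s t hs => Subgroup.Normal.conj_mem inferInstance s hs t
        rw [bracketHom_mk_mk i j, bracketHom_mk_mk j k, bracketHom_mk_mk k i,
          bracketHom_conj (comm x y) y z ⟨_, hn k z y z.2⟩ rfl,
          bracketHom_conj (comm y z) z x ⟨_, hn i x z x.2⟩ rfl,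
          bracketHom_conj (comm z x) x y ⟨_, hn j y x y.2⟩ rfl,
          bracketHom_mk_mk, bracketHom_mk_mk, bracketHom_mk_mk]
        have e2 : j + k + 1 + i + 1 = i + j + 1 + k + 1 := by ring
        have e3 : k + i + 1 + j + 1 = i + j + 1 + k + 1 := by ring
        rw [of_mk_congr e2 _ ⟨_, lcs_le e2.ge (comm (comm y z) ⟨_, hn i x z x.2⟩).2⟩ (by rw [inv_mul_cancel]; exact one_mem _),
          of_mk_congr e3 _ ⟨_, lcs_le e3.ge (comm (comm z x) ⟨_, hn j y x y.2⟩).2⟩ (by rw [inv_mul_cancel]; exact one_mem _),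
          ← of_mk_mul, ← of_mk_mul, ← of_mk_one]
        congr 2
        ext
        exact hall_witt (x : G) (y : G) (z : G)

/-- The Lie ring (Lie algebra over `ℤ`) `gr_*(G)` of the descending central series of `G`. -/
noncomputable instance instLieRingGr : LieRing (Gr G) where
  add_lie a b c := by simp only [bracket_def, map_add, AddMonoidHom.add_apply]
  lie_add a b c := by simp only [bracket_def, map_add]
  lie_self a := bracketHom_self a
  leibniz_lie a b c := by
    simp only [bracket_def]
    have h := jacobi_cyclic a b c
    have h1 := bracketHom_swap (bracketHom b c) a
    have h2 := bracketHom_swap (bracketHom c a) b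
    have h3 : bracketHom b (bracketHom a c) = - bracketHom b (bracketHom c a) := by
      rw [eq_neg_of_add_eq_zero_left (bracketHom_swap a c), map_neg]
    rw [h3, ← eq_neg_of_add_eq_zero_left h2]
    rw [eq_neg_of_add_eq_zero_right h1, neg_eq_iff_add_eq_zero, ← h]
    abel

end DescendingCentralSeries

/-! ### Conjugation on the homology of a normal subgroup -/

/-- The trivial `N`-module `ℤ` (`ULift ℤ` is the ring of integers, placed in the universe of
`N`). -/
noncomputable abbrev trivialIntRep (N : Type u) [Group N] : Rep.{u} (ULift.{u} ℤ) N :=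
  Rep.trivial (ULift.{u} ℤ) N (ULift.{u} ℤ)

/-- The identity of `ℤ`, as a map from the trivial module to its restriction along `f`. -/
noncomputable def trivialIntRepHom {N : Type u} [Group N] (f : N →* N) :
    trivialIntRep N ⟶ Rep.res f (trivialIntRep N) :=
  Rep.ofHom ⟨LinearMap.id, fun _ => rfl⟩

/-- The endomorphism of the integral homology group `H_q(N; ℤ)` induced by a group endomorphism
`f` of `N`. -/
noncomputable def integralHomologyMap {N : Type u} [Group N] (f : N →* N) (q : ℕ) :
    groupHomology (trivialIntRep N) q ⟶ groupHomology (trivialIntRep N) q :=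
  groupHomology.map f (trivialIntRepHom f) q

open CategoryTheory in
/-- For an epimorphism `p : G → Q` with kernel `N`, an element `x` of `Q` acts on `H_*(N; ℤ)`
through conjugation of `N` by any `g` with `p g = x` (the choice of `g` does not matter, as `N`
acts trivially on its own homology). This says that `Q` acts trivially on `H_q(N; ℤ)` for
every `q`. -/
def ActsTriviallyOnKernelHomology {G Q : Type u} [Group G] [Group Q] (p : G →* Q) : Prop :=
  ∀ (x : Q) (g : G), p g = x → ∀ q : ℕ,
    integralHomologyMap (MulAut.conjNormal (H := p.ker) g).toMonoidHom q = 𝟙 _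

/-!
Let `K` be the kernel of `p : G → Q`, one of the split epimorphisms of the tower. Trivial action on
`H_1(K; ℤ) = Kᵃᵇ` means `[K, G] ≤ [K, K]`; from this the three subgroups lemma gives, as Falk and
Randell showed, `G_m ∩ K = K_m` for all `m` (`DescendingCentralSeries.mul_inv_section_mem`). So
`gr_*(K)` is an ideal of `gr_*(G)` with quotient `gr_*(Q)`. A central element of `gr_*(G)` maps to a
central element of `gr_*(Q)`; if it maps to `0`, it is in the center of `gr_*(K)`. As `K` is free of
rank at least two, this center is trivial, and the center of `gr_*(G)` embeds in that of `gr_*(Q)`.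
The same holds for the centers of the groups themselves. By induction everything is reduced to
`Γ 0`: if its rank is at least two, both centers are trivial; otherwise `Γ 0` is cyclic, and so is
`gr_*(Γ 0)`.

That the center of `gr_*(F)` is trivial for a free group `F` of rank at least two follows from the
theorem of Magnus and Witt that `gr_*(F)` embeds in the free associative ring on the generators,
where only scalars commute with two distinct generators. The Magnus representation `x ↦ 1 + x T`
gives the map `ψ` from `gr_*(F)` to the free associative ring, by leading coefficients
(`PowerSeries.exists_lieHom_gr`). As `gr_*(F)` is generated in degree one, it is a quotient of the
free Lie ring, and `ψ` is injective if each Lie polynomial `t` that vanishes as an associative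
polynomial also vanishes in `gr_*(F)`. This is proved by Lazard elimination, without the
Poincaré-Birkhoff-Witt theorem: for each generator `x`, such a `t` is a Lie polynomial in the
elements `(ad x)^k y` with `y ≠ x`, and vanishes as an associative polynomial in these
(`FreeLieAlgebra.exists_eq_elim_of_toFreeAlgebra_eq_zero`). Eliminating repeatedly generators of
least weight, one sees that the image of `t` in `gr_*(F)` has no component in any degree
(`FreeLieAlgebra.lift_mem_of_toFreeAlgebra_eq_zero`).
-/

/-! ### Free Lie algebras: elimination of a generator, and embedding in the free algebra -/

section FreeLie

-- the commutator bracket of an associative ring is not a global instance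
attribute [local instance 100] LieRing.ofAssociativeRing

namespace FreeLieAlgebra

variable {R : Type*} [CommRing R] {X : Type v}

theorem mem_of_forall_of_mem {S : LieSubalgebra R (FreeLieAlgebra R X)}
    (h : ∀ x, of R x ∈ S) (t : FreeLieAlgebra R X) : t ∈ S := by
  have key : S.incl.comp (lift R fun x => (⟨of R x, h x⟩ : S)) = LieHom.id := by
    ext x
    simp
  have := DFunLike.congr_fun key t
  simp only [LieHom.coe_comp, Function.comp_apply, LieHom.coe_id, id_eq] at this
  rw [← this]
  exact (lift R (fun x => (⟨of R x, h x⟩ : S)) t).2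

theorem induction_on' {P : FreeLieAlgebra R X → Prop} (t : FreeLieAlgebra R X)
    (hof : ∀ x, P (of R x)) (h0 : P 0) (hadd : ∀ s t, P s → P t → P (s + t))
    (hsmul : ∀ (c : R) s, P s → P (c • s)) (hlie : ∀ s t, P s → P t → P ⁅s, t⁆) : P t :=
  mem_of_forall_of_mem (S :=
    { carrier := {t | P t}
      add_mem' := hadd _ _
      zero_mem' := h0
      smul_mem' := hsmul
      lie_mem' := hlie _ _ }) hof t

variable (R X) in
/-- The canonical Lie algebra homomorphism from the free Lie algebra on `X` to the free associative
algebra on `X`. -/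
noncomputable def toFreeAlgebra : FreeLieAlgebra R X →ₗ⁅R⁆ FreeAlgebra R X :=
  lift R (FreeAlgebra.ι R)

@[simp]
theorem toFreeAlgebra_of (x : X) : toFreeAlgebra R X (of R x) = FreeAlgebra.ι R x :=
  lift_of_apply _ _

theorem algebraMapInv_toFreeAlgebra (t : FreeLieAlgebra R X) :
    FreeAlgebra.algebraMapInv (toFreeAlgebra R X t) = 0 := by
  induction t using induction_on' with
  | hof x => simp [FreeAlgebra.algebraMapInv]
  | h0 => simp
  | hadd s t hs ht => simp [hs, ht]
  | hsmul c s hs => simp [hs]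
  | hlie s t hs ht => simp [LieRing.of_associative_ring_bracket, hs, ht]

/-- The generators that replace those other than `x` when `x` is eliminated: `(y, k)` stands for
`(ad x)^k y`. -/
abbrev ElimIndex (x : X) : Type v := {y : X // y ≠ x} × ℕ

/-- The element `(ad e_x)^k e_y` of index `(y, k)`. -/
noncomputable def elimGen {L : Type*} [LieRing L] [LieAlgebra R L] (e : X → L) (x : X)
    (j : ElimIndex x) : L :=
  (fun z => ⁅e x, z⁆)^[j.2] (e j.1)

theorem lie_smul_add_smul_add {L : Type*} [LieRing L] [LieAlgebra R L] (a b : R) (u p q : L) :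
    ⁅a • u + p, b • u + q⁆ = a • ⁅u, q⁆ - b • ⁅u, p⁆ + ⁅p, q⁆ := by
  rw [lie_add, add_lie, add_lie, smul_lie, smul_lie, lie_smul, lie_self, smul_zero, smul_zero,
    lie_smul, ← lie_skew p u]
  module

/-- The generating half of Lazard elimination: the free Lie algebra on `X` is spanned by `x` and the
subalgebra generated by the `(ad x)^k y`, because `ad x` maps this subalgebra to itself. -/
theorem exists_eq_smul_add_elim (x : X) (t : FreeLieAlgebra R X) :
    ∃ (a : R) (s : FreeLieAlgebra R (ElimIndex x)),
      t = a • of R x + lift R (elimGen (R := R) (of R) x) s := by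
  set Ψ := lift R (elimGen (R := R) (of R) x) with hΨ
  have had : ∀ s, ∃ s', ⁅of R x, Ψ s⁆ = Ψ s' := by
    intro s
    induction s using induction_on' with
    | hof j =>
      refine ⟨of R (j.1, j.2 + 1), ?_⟩
      simp only [hΨ, lift_of_apply, elimGen, Function.iterate_succ_apply']
    | h0 => exact ⟨0, by simp⟩
    | hadd s t hs ht =>
      obtain ⟨s', hs⟩ := hs
      obtain ⟨t', ht⟩ := ht
      exact ⟨s' + t', by simp [hs, ht]⟩
    | hsmul c s hs =>
      obtain ⟨s', hs⟩ := hs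
      exact ⟨c • s', by simp [hs]⟩
    | hlie s t hs ht =>
      obtain ⟨s', hs⟩ := hs
      obtain ⟨t', ht⟩ := ht
      exact ⟨⁅s', t⁆ + ⁅s, t'⁆, by simp [hs, ht, leibniz_lie]⟩
  induction t using induction_on' with
  | hof y =>
    by_cases h : y = x
    · exact ⟨1, 0, by simp [h]⟩
    · exact ⟨0, of R (⟨y, h⟩, 0), by simp [hΨ, lift_of_apply, elimGen]⟩
  | h0 => exact ⟨0, 0, by simp⟩
  | hadd s t hs ht =>
    obtain ⟨a, s, rfl⟩ := hs
    obtain ⟨b, t, rfl⟩ := ht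
    exact ⟨a + b, s + t, by rw [map_add, add_smul]; abel⟩
  | hsmul c s hs =>
    obtain ⟨a, s, rfl⟩ := hs
    exact ⟨c * a, c • s, by rw [smul_add, map_smul, mul_smul]⟩
  | hlie s t hs ht =>
    obtain ⟨a, s, rfl⟩ := hs
    obtain ⟨b, t, rfl⟩ := ht
    obtain ⟨s', hs⟩ := had s
    obtain ⟨t', ht⟩ := had t
    refine ⟨0, a • t' - b • s' + ⁅s, t⁆, ?_⟩
    rw [lie_smul_add_smul_add, hs, ht, zero_smul, zero_add, map_add, map_sub, map_smul, map_smul,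
      LieHom.map_lie]

end FreeLieAlgebra

namespace FreeAlgebra

variable {R : Type*} [CommRing R] {X : Type v}

/-- A derivation of a free algebra may be prescribed on the generators: it is the second component
of an algebra homomorphism to the dual numbers. -/
theorem exists_derivation (d : X → FreeAlgebra R X) :
    ∃ D : Module.End R (FreeAlgebra R X), (∀ x, D (ι R x) = d x) ∧
      ∀ a b, D (a * b) = a * D b + D a * b := by
  let F : FreeAlgebra R X →ₐ[R] DualNumber (FreeAlgebra R X) :=
    lift R fun x => TrivSqZeroExt.inl (ι R x) + TrivSqZeroExt.inr (d x)
  have hfst : ∀ a, (F a).fst = a := by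
    have : (TrivSqZeroExt.fstHom R (FreeAlgebra R X) (FreeAlgebra R X)).comp F = AlgHom.id R _ := by
      ext x
      simp [F]
    exact DFunLike.congr_fun this
  refine ⟨(TrivSqZeroExt.sndHom (FreeAlgebra R X) (FreeAlgebra R X)).restrictScalars R ∘ₗ
    F.toLinearMap, ?_, ?_⟩
  · intro x
    simp [F]
  · intro a b
    simp [hfst]

/-- An element of a free algebra that commutes with two distinct generators is a scalar; so it
vanishes if its constant term does. -/
theorem eq_zero_of_commute {a b : X} (hab : a ≠ b) {c : FreeAlgebra R X}
    (ha : Commute c (ι R a)) (hb : Commute c (ι R b)) (hc : algebraMapInv c = 0) : c = 0 := by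
  classical
  let e := equivMonoidAlgebraFreeMonoid (R := R) (X := X)
  set f := e c with hf
  have he : ∀ x, e (ι R x) = MonoidAlgebra.single (FreeMonoid.of x) 1 := by
    intro x
    simp [e, equivMonoidAlgebraFreeMonoid, MonoidAlgebra.of]
  -- if `w` does not begin with `x`, then `w x` occurs in `c x` as often as `w` in `c`, and in `x c`
  -- not at all
  have hcomm : ∀ x, Commute c (ι R x) → ∀ w : FreeMonoid X,
      (∀ w', w ≠ FreeMonoid.of x * w') → w ≠ 1 → f.coeff w = 0 := by
    intro x hx w hw hw1
    have h := congrArg (fun g => (e g).coeff (w * FreeMonoid.of x)) hx.eq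
    simp only [map_mul, he] at h
    rw [MonoidAlgebra.coeff_mul_single_eq_coeff_mul w (by simp), mul_one,
      MonoidAlgebra.coeff_single_mul_of_forall_mul_ne] at h
    · exact h
    · intro d hd
      cases w using FreeMonoid.casesOn with
      | one => exact hw1 rfl
      | of_mul y w =>
        have := congrArg FreeMonoid.toList hd
        simp at this
        exact hw w (by rw [this.1])
  have hsupp : ∀ w : FreeMonoid X, w ≠ 1 → f.coeff w = 0 := by
    intro w hw1
    by_cases hw : ∀ w', w ≠ FreeMonoid.of a * w'
    · exact hcomm a ha w hw hw1
    · push Not at hw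
      obtain ⟨w', rfl⟩ := hw
      refine hcomm b hb _ (fun w'' h => ?_) hw1
      have := congrArg FreeMonoid.toList h
      simp at this
      exact hab this.1
  have hf1 : f = algebraMap R _ (f.coeff 1) := by
    ext w
    by_cases hw : w = 1
    · subst hw; simp
    · simp [hsupp w hw, MonoidAlgebra.coeff_single, Ne.symm hw]
  have hc1 : c = algebraMap R _ (f.coeff 1) := by
    apply e.injective
    rw [← hf, AlgEquiv.commutes, ← hf1]
  rw [hc1, AlgHom.commutes] at hc
  rw [hc1]
  simpa using congrArg (algebraMap R (FreeAlgebra R X)) hc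

end FreeAlgebra

namespace FreeLieAlgebra

variable {R : Type*} [CommRing R] {X : Type v}

/-- An element of the free Lie algebra on `X` that vanishes in the free associative algebra comes,
for each `x`, from such an element of the free Lie algebra on the `(ad x)^k y`.

The free associative algebra on `X` acts on the one, `U`, on the pairs `(y, k)`: the generator `x`
acts as the derivation `D` with `D (y, k) = (y, k + 1)`, and `y ≠ x` as left multiplication by
`(y, 0)`. Then `(ad x)^k y` acts as left multiplication by `(y, k)`, so the image of an element `s`
of the free Lie algebra on the pairs acts as left multiplication by the associative polynomial
of `s`. Evaluation at `1`, which `D` annihilates, recovers this polynomial. -/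
theorem exists_eq_elim_of_toFreeAlgebra_eq_zero (x : X) {t : FreeLieAlgebra R X}
    (ht : toFreeAlgebra R X t = 0) :
    ∃ s : FreeLieAlgebra R (ElimIndex x), toFreeAlgebra R _ s = 0 ∧
      t = lift R (elimGen (R := R) (of R) x) s := by
  classical
  obtain ⟨a, s, rfl⟩ := exists_eq_smul_add_elim x t
  set Ψ := lift R (elimGen (R := R) (of R) x) with hΨ
  obtain ⟨D, hD, hDmul⟩ := FreeAlgebra.exists_derivation (R := R)
    fun j : ElimIndex x => FreeAlgebra.ι R (j.1, j.2 + 1)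
  let U := FreeAlgebra R (ElimIndex x)
  let ρ : FreeAlgebra R X →ₐ[R] Module.End R U := FreeAlgebra.lift R fun y =>
    if h : y = x then D else LinearMap.mulLeft R (FreeAlgebra.ι R (⟨y, h⟩, 0))
  have hDlie : ∀ u : U, ⁅D, LinearMap.mulLeft R u⁆ = LinearMap.mulLeft R (D u) := by
    intro u
    ext v
    simp [LieRing.of_associative_ring_bracket, hDmul]
  have hgen : ∀ (y : {y : X // y ≠ x}) (k : ℕ),
      ρ (toFreeAlgebra R X (elimGen (R := R) (of R) x (y, k))) =
        LinearMap.mulLeft R (FreeAlgebra.ι R (y, k)) := by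
    intro y k
    induction k with
    | zero => simp [elimGen, ρ, y.2]
    | succ k ih =>
      have : elimGen (R := R) (of R) x (y, k + 1) = ⁅of R x, elimGen (R := R) (of R) x (y, k)⁆ := by
        simp only [elimGen, Function.iterate_succ_apply']
      rw [this, LieHom.map_lie, LieRing.of_associative_ring_bracket, map_sub, map_mul, map_mul, ih]
      have hx : ρ (toFreeAlgebra R X (of R x)) = D := by simp [ρ]
      rw [hx, ← LieRing.of_associative_ring_bracket, hDlie, hD]
  have hact : ∀ s, ρ (toFreeAlgebra R X (Ψ s)) = LinearMap.mulLeft R (toFreeAlgebra R _ s) := by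
    intro s
    induction s using induction_on' with
    | hof j => rw [hΨ, lift_of_apply, hgen, toFreeAlgebra_of]
    | h0 => simp
    | hadd s t hs ht => simp only [map_add, hs, ht]; ext; simp [add_mul]
    | hsmul c s hs => simp only [map_smul, hs]; ext; simp
    | hlie s t hs ht =>
      simp only [LieHom.map_lie, LieRing.of_associative_ring_bracket, map_sub, map_mul, hs, ht]
      ext v
      simp [sub_mul, mul_assoc]
  have hD1 : D 1 = 0 := by
    have := hDmul 1 1
    simpa using this
  have hs : toFreeAlgebra R _ s = 0 := by
    have h := congrArg (fun g => ρ g (1 : U)) ht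
    have hx : ρ (FreeAlgebra.ι R x) = D := by simp [ρ]
    simpa [hact, hD1, hx] using h
  have hΨs : toFreeAlgebra R X (Ψ s) = 0 := by
    have key : ∀ s, toFreeAlgebra R X (Ψ s) = FreeAlgebra.lift R
        (fun j => toFreeAlgebra R X (elimGen (R := R) (of R) x j)) (toFreeAlgebra R _ s) := by
      intro s
      induction s using induction_on' with
      | hof j => simp [hΨ, lift_of_apply]
      | h0 => simp
      | hadd s t hs ht => simp only [map_add, hs, ht]
      | hsmul c s hs => simp only [map_smul, hs]
      | hlie s t hs ht =>
        simp only [LieHom.map_lie, LieRing.of_associative_ring_bracket, map_sub, map_mul, hs, ht]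
    rw [key, hs, map_zero]
  have ha : a = 0 := by
    rw [map_add, hΨs, add_zero, map_smul, toFreeAlgebra_of] at ht
    simpa using congrArg (FreeAlgebra.lift R fun _ => (1 : R)) ht
  exact ⟨s, hs, by rw [ha, zero_smul, zero_add]⟩

section Filtration

variable {L : Type*} [LieRing L] [LieAlgebra R L] (V : ℕ → Submodule R L)

theorem elimGen_mem (hlie : ∀ i j a b, a ∈ V i → b ∈ V j → ⁅a, b⁆ ∈ V (i + j))
    {e : X → L} {w : X → ℕ} (he : ∀ i, e i ∈ V (w i)) (x : X) (j : ElimIndex x) :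
    elimGen (R := R) e x j ∈ V (j.2 * w x + w j.1) := by
  obtain ⟨y, k⟩ := j
  induction k with
  | zero => simpa [elimGen] using he y
  | succ k ih =>
    have := hlie _ _ _ _ (he x) ih
    simp only [elimGen, Function.iterate_succ_apply'] at this ⊢
    convert this using 2
    ring

theorem lift_elimGen (e : X → L) (x : X) (s : FreeLieAlgebra R (ElimIndex x)) :
    lift R (elimGen (R := R) e x) s = lift R e (lift R (elimGen (R := R) (of R) x) s) := by
  have : (lift R e).comp (lift R (elimGen (R := R) (of R) x)) = lift R (elimGen (R := R) e x) := by
    ext j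
    obtain ⟨y, k⟩ := j
    simp only [LieHom.coe_comp, Function.comp_apply, lift_of_apply]
    induction k with
    | zero => simp [elimGen]
    | succ k ih =>
      simp only [elimGen, Function.iterate_succ_apply'] at ih ⊢
      rw [LieHom.map_lie, ih, lift_of_apply]
  rw [← this, LieHom.comp_apply]

/-- The form of `lift_mem_of_toFreeAlgebra_eq_zero` for generators of various weights, finitely many
of them below `n`. All weights are at least `m`, and the generators of weight `m` are eliminated one
at a time: eliminating `x` adds generators of weight greater than `m` only. When none is left, `m`
grows by one; once `m` reaches `n`, everything lies in `V n`. -/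
theorem lift_mem_of_weights (hanti : Antitone V)
    (hlie : ∀ i j a b, a ∈ V i → b ∈ V j → ⁅a, b⁆ ∈ V (i + j)) (n d : ℕ) :
    ∀ m, n ≤ m + d → 1 ≤ m → ∀ (X : Type v) (e : X → L) (w : X → ℕ), (∀ i, e i ∈ V (w i)) →
      (∀ i, m ≤ w i) → {i | w i < n}.Finite → ∀ t : FreeLieAlgebra R X,
        toFreeAlgebra R X t = 0 → lift R e t ∈ V n := by
  induction d with
  | zero =>
    intro m hm _ X e w he hw _ t ht
    clear ht
    induction t using induction_on' with
    | hof x => rw [lift_of_apply]; exact hanti (hm.trans (hw x)) (he x)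
    | h0 => simp
    | hadd s t hs ht => rw [map_add]; exact add_mem hs ht
    | hsmul c s hs => rw [map_smul]; exact Submodule.smul_mem _ _ hs
    | hlie s t hs ht =>
      rw [LieHom.map_lie]
      exact hanti (Nat.le_add_left n n) (hlie _ _ _ _ hs ht)
  | succ d ih =>
    intro m hm hm1
    suffices H : ∀ (N : ℕ) (X : Type v) (e : X → L) (w : X → ℕ), (∀ i, e i ∈ V (w i)) →
        (∀ i, m ≤ w i) → {i | w i < n}.Finite → {i | w i < n ∧ w i = m}.ncard = N →
        ∀ t : FreeLieAlgebra R X, toFreeAlgebra R X t = 0 → lift R e t ∈ V n from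
      fun X e w he hw hfin t ht => H _ X e w he hw hfin rfl t ht
    intro N
    induction N using Nat.strong_induction_on with
    | _ N ihN =>
    intro X e w he hw hfin hN t ht
    by_cases hx : ∃ x, w x = m ∧ w x < n
    · obtain ⟨x, hxm, hxn⟩ := hx
      obtain ⟨s, hs, rfl⟩ := exists_eq_elim_of_toFreeAlgebra_eq_zero x ht
      rw [← lift_elimGen]
      refine ihN _ ?_ (ElimIndex x) (elimGen (R := R) e x) (fun j => j.2 * w x + w j.1)
        (elimGen_mem V hlie he x) (fun j => (hw j.1).trans (Nat.le_add_left _ _)) ?_ rfl s hs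
      · rw [← hN]
        have hsub : (fun j : ElimIndex x => (j.1 : X)) ''
              {j | j.2 * w x + w j.1 < n ∧ j.2 * w x + w j.1 = m} ⊆
            {i | w i < n ∧ w i = m} \ {x} := by
          rintro _ ⟨⟨y, k⟩, ⟨h1, h2⟩, rfl⟩
          simp only at h1 h2
          have := hw y
          exact ⟨⟨by simp only; omega, by simp only; omega⟩, y.2⟩
        have hinj : Set.InjOn (fun j : ElimIndex x => (j.1 : X))
            {j | j.2 * w x + w j.1 < n ∧ j.2 * w x + w j.1 = m} := by
          have key : ∀ j : ElimIndex x, j.2 * w x + w j.1 = m → j.2 = 0 := by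
            intro j hj
            by_contra h0
            have h1 := hw j.1
            have h2 : 0 < j.2 * w x := Nat.mul_pos (Nat.pos_of_ne_zero h0) (by omega)
            omega
          rintro j ⟨_, hj⟩ j' ⟨_, hj'⟩ h
          exact Prod.ext (Subtype.ext h) ((key j hj).trans (key j' hj').symm)
        have hfin' : {i | w i < n ∧ w i = m}.Finite := hfin.subset fun i hi => hi.1
        rw [← hinj.ncard_image]
        exact (Set.ncard_le_ncard hsub (hfin'.subset Set.sdiff_subset)).trans_lt
          (Set.ncard_sdiff_singleton_lt_of_mem ⟨hxn, hxm⟩ hfin')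
      · have : Set.Finite ((Subtype.val ⁻¹' {i | w i < n} : Set {y // y ≠ x}) ×ˢ Set.Iio n) :=
          (hfin.preimage Subtype.val_injective.injOn).prod (Set.finite_Iio n)
        refine this.subset fun j hj => ?_
        have h1 : j.2 ≤ j.2 * w x := Nat.le_mul_of_pos_right _ (by omega)
        simp only [Set.mem_ofPred_eq] at hj
        exact ⟨by simp only [Set.mem_preimage, Set.mem_ofPred_eq]; omega,
          by simp only [Set.mem_Iio]; omega⟩
    · push Not at hx
      by_cases hnm : n ≤ m
      · exact ih m (by omega) hm1 X e w he hw hfin t ht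
      · exact ih (m + 1) (by omega) (by omega) X e w he
          (fun i => by have := hw i; have := hx i; omega) hfin t ht

theorem exists_finite_support (t : FreeLieAlgebra R X) :
    ∃ S : Set X, S.Finite ∧ ∀ e e' : X → L, (∀ i ∈ S, e i = e' i) → lift R e t = lift R e' t := by
  induction t using induction_on' with
  | hof x => exact ⟨{x}, Set.finite_singleton x, fun e e' h => by simp [lift_of_apply, h]⟩
  | h0 => exact ⟨∅, Set.finite_empty, by simp⟩
  | hadd s t hs ht =>
    obtain ⟨S, hS, hs⟩ := hs
    obtain ⟨T, hT, ht⟩ := ht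
    exact ⟨S ∪ T, hS.union hT, fun e e' h => by
      rw [map_add, map_add, hs e e' fun i hi => h i (.inl hi),
        ht e e' fun i hi => h i (.inr hi)]⟩
  | hsmul c s hs =>
    obtain ⟨S, hS, hs⟩ := hs
    exact ⟨S, hS, fun e e' h => by rw [map_smul, map_smul, hs e e' h]⟩
  | hlie s t hs ht =>
    obtain ⟨S, hS, hs⟩ := hs
    obtain ⟨T, hT, ht⟩ := ht
    exact ⟨S ∪ T, hS.union hT, fun e e' h => by
      rw [LieHom.map_lie, LieHom.map_lie, hs e e' fun i hi => h i (.inl hi),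
        ht e e' fun i hi => h i (.inr hi)]⟩

/-- If `t` vanishes in the free associative algebra, then every substitution of elements of the
first stage of a filtration sends `t` into all of its stages. -/
theorem lift_mem_of_toFreeAlgebra_eq_zero (hanti : Antitone V)
    (hlie : ∀ i j a b, a ∈ V i → b ∈ V j → ⁅a, b⁆ ∈ V (i + j)) {e : X → L} (he : ∀ i, e i ∈ V 1)
    {t : FreeLieAlgebra R X} (ht : toFreeAlgebra R X t = 0) (n : ℕ) : lift R e t ∈ V n := by
  classical
  -- outside a finite support of `t`, the generators may be sent to `0`, whose weight may be taken
  -- to be as large as needed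
  obtain ⟨S, hS, hSe⟩ := exists_finite_support (L := L) t
  rw [hSe e (fun i => if i ∈ S then e i else 0) fun i hi => by simp [hi]]
  refine lift_mem_of_weights V hanti hlie n n 1 (by omega) le_rfl X _
    (fun i => if i ∈ S then 1 else n + 1) (fun i => ?_) (fun i => ?_) ?_ t ht
  · split_ifs
    · exact he i
    · exact zero_mem _
  · split_ifs <;> omega
  · refine hS.subset fun i hi => ?_
    by_contra h
    simp [h] at hi

end Filtration

end FreeLieAlgebra

end FreeLie

/-! ### The graded pieces of the Lie ring of the descending central series -/

section Magnus

open DescendingCentralSeries PowerSeries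
open scoped commutatorElement DirectSum

attribute [local instance 100] LieRing.ofAssociativeRing

-- Over `ℤ`, these structures compete with the ones that every Lie ring and every ring has.
attribute [local instance 10000] FreeLieAlgebra.instLieAlgebra FreeAlgebra.instAlgebra
  LieAlgebra.ofAssociativeAlgebra

namespace DescendingCentralSeries

theorem mem_lcs_zero {G : Type u} [Group G] (g : G) : g ∈ lcs G 0 := Subgroup.mem_top g

/-- The class in `gr_1(G)` of an element of `G`. -/
noncomputable def degreeOne {G : Type u} [Group G] (g : G) : Gr G :=
  of 0 (mk 0 ⟨g, mem_lcs_zero g⟩)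

/-- The Lie ring of the descending central series is generated in degree one. -/
theorem eq_top_of_forall_mk_mem {G : Type u} [Group G] {T : Set G} (hT : Subgroup.closure T = ⊤)
    {S : LieSubalgebra ℤ (Gr G)}
    (h : ∀ g ∈ T, degreeOne g ∈ S) : S = ⊤ := by
  let P : ℕ → G → Prop := fun m g => ∃ hg : g ∈ lcs G m, of m (mk m ⟨g, hg⟩) ∈ S
  have hone : ∀ m, P m 1 := fun m => ⟨one_mem _, by
    have := of_mk_one (G := G) m
    exact this ▸ S.zero_mem⟩
  have hmul : ∀ m g h, P m g → P m h → P m (g * h) := by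
    rintro m g h ⟨hg, hg'⟩ ⟨hh, hh'⟩
    refine ⟨mul_mem hg hh, ?_⟩
    have := of_mk_mul m ⟨g, hg⟩ ⟨h, hh⟩
    exact this ▸ S.add_mem hg' hh'
  have hinv : ∀ m g, P m g → P m g⁻¹ := by
    rintro m g ⟨hg, hg'⟩
    refine ⟨inv_mem hg, ?_⟩
    have : of m (mk m ⟨g⁻¹, inv_mem hg⟩) = -of m (mk m ⟨g, hg⟩) := by
      rw [eq_neg_iff_add_eq_zero, ← of_mk_mul, ← of_mk_one m]
      congr 2
      ext
      simp
    exact this ▸ S.neg_mem hg'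
  have h0 : ∀ g, P 0 g := by
    intro g
    have hg : g ∈ Subgroup.closure T := hT ▸ Subgroup.mem_top g
    exact Subgroup.closure_induction (p := fun g _ => P 0 g)
      (fun g hg => ⟨mem_lcs_zero g, h g hg⟩) (hone 0) (fun g h _ _ => hmul 0 g h)
      (fun g _ => hinv 0 g) hg
  have hP : ∀ m, ∀ g ∈ lcs G m, P m g := by
    intro m
    induction m with
    | zero => exact fun g _ => h0 g
    | succ m ih =>
      intro g hg
      refine Subgroup.closure_induction (p := fun g _ => P (m + 1) g) ?_ (hone _)
        (fun g h _ _ => hmul _ g h) (fun g _ => hinv _ g) hg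
      rintro _ ⟨p, hp, q, -, rfl⟩
      obtain ⟨hp, hp'⟩ := ih p hp
      obtain ⟨hq, hq'⟩ := h0 q
      refine ⟨Subgroup.commutator_mem_commutator hp hq, ?_⟩
      have := S.lie_mem hp' hq'
      rw [bracket_def, bracketHom_mk_mk] at this
      exact this
  rw [eq_top_iff]
  rintro x -
  induction x using gr_induction with
  | h0 => exact S.zero_mem
  | hof i g => exact (hP i g g.2).2
  | hadd a b ha hb => exact S.add_mem ha hb

/-- The homogeneous component of degree `i + 1`. -/
noncomputable def comp {G : Type u} [Group G] (i : ℕ) : Gr G →+ GrPiece G i :=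
  DFinsupp.evalAddMonoidHom i

theorem comp_of_self {G : Type u} [Group G] (i : ℕ) (x : GrPiece G i) : comp i (of i x) = x :=
  DirectSum.of_eq_same i x

theorem comp_of_ne {G : Type u} [Group G] {i j : ℕ} (h : i ≠ j) (x : GrPiece G i) :
    comp j (of i x) = 0 :=
  DirectSum.of_eq_of_ne i j x h.symm

theorem ext_comp {G : Type u} [Group G] {x y : Gr G} (h : ∀ i, comp i x = comp i y) : x = y :=
  DFinsupp.ext h

theorem of_mk_eq_zero_iff {G : Type u} [Group G] {i : ℕ} (x : lcs G i) :
    of i (mk i x) = 0 ↔ (x : G) ∈ lcs G (i + 1) := by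
  have h1 : of i (mk i x) = 0 ↔ mk i x = 0 :=
    ⟨fun h => by rw [← comp_of_self i (mk i x), h, map_zero], fun h => by rw [h, map_zero]⟩
  rw [h1]
  have h2 : mk i x = 0 ↔ mkMul i 1 = mkMul i x := eq_comm
  rw [h2, mkMul_eq_iff]
  simp

/-- The span of the homogeneous parts of degree at least `n`. -/
noncomputable def grGE {G : Type u} [Group G] (n : ℕ) : Submodule ℤ (Gr G) :=
  (⨆ (i) (_ : n ≤ i + 1), (of (G := G) i).range).toIntSubmodule

theorem of_mem_grGE {G : Type u} [Group G] {i n : ℕ} (x : GrPiece G i) (h : n ≤ i + 1) :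
    of i x ∈ grGE (G := G) n :=
  AddSubgroup.mem_iSup_of_mem i (AddSubgroup.mem_iSup_of_mem h ⟨x, rfl⟩)

theorem grGE_induction {G : Type u} [Group G] {n : ℕ} {P : Gr G → Prop} {a : Gr G}
    (ha : a ∈ grGE n) (h0 : P 0)
    (hof : ∀ i (x : lcs G i), n ≤ i + 1 → P (of i (mk i x))) (hadd : ∀ a b, P a → P b → P (a + b)) :
    P a := by
  refine AddSubgroup.iSup_induction' (C := fun a _ => P a) _ (fun i x hx => ?_) h0
    (fun a b _ _ => hadd a b) ha
  refine AddSubgroup.iSup_induction' (C := fun a _ => P a) _ (fun h x hx => ?_) h0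
    (fun a b _ _ => hadd a b) hx
  obtain ⟨x, rfl⟩ := hx
  induction x using Additive.rec with | _ x
  induction x using QuotientGroup.induction_on with | _ x
  exact hof i x h

theorem grGE_antitone {G : Type u} [Group G] : Antitone (grGE (G := G)) := by
  intro m n hmn a ha
  refine grGE_induction ha (zero_mem _) (fun i x hi => of_mem_grGE _ (hmn.trans hi))
    fun a b => add_mem

theorem lie_mem_grGE {G : Type u} [Group G] {m n : ℕ} {a b : Gr G} (ha : a ∈ grGE m)
    (hb : b ∈ grGE n) : ⁅a, b⁆ ∈ grGE (G := G) (m + n) := by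
  refine grGE_induction (P := fun a => ⁅a, b⁆ ∈ grGE (m + n)) ha (by simp) (fun i x hi => ?_)
    fun a b ha hb => ?_
  · refine grGE_induction (P := fun b => ⁅of i (mk i x), b⁆ ∈ grGE (m + n)) hb (by simp)
      (fun j y hj => ?_) fun a b ha hb => ?_
    · rw [bracket_def, bracketHom_mk_mk]
      exact of_mem_grGE _ (by omega)
    · rw [lie_add]
      exact add_mem ha hb
  · rw [add_lie]
    exact add_mem ha hb

theorem eq_zero_of_forall_mem_grGE {G : Type u} [Group G] {a : Gr G} (h : ∀ n, a ∈ grGE n) :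
    a = 0 := by
  refine ext_comp fun i => ?_
  rw [map_zero]
  refine grGE_induction (P := fun a => comp i a = 0) (h (i + 2)) (map_zero _) (fun j x hj => ?_)
    fun a b ha hb => by rw [map_add, ha, hb, add_zero]
  exact comp_of_ne (by omega) _

end DescendingCentralSeries

/-! ### Leading coefficients of representations in power series -/

namespace PowerSeries

variable {A : Type*} [Ring A]

theorem X_pow_mul_mul_X_pow_mul (m n : ℕ) (a b : A⟦X⟧) :
    X ^ m * a * (X ^ n * b) = X ^ (m + n) * (a * b) := by
  rw [pow_add, mul_assoc, ← mul_assoc a, (commute_X_pow a n).eq]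
  simp only [mul_assoc]

/-- The leading coefficient of the group commutator of two power series is the commutator of their
leading coefficients, since `u v u⁻¹ v⁻¹ - 1 = (u v - v u) (v u)⁻¹`. -/
theorem exists_commutatorElement_eq {u v : A⟦X⟧ˣ} {m n : ℕ} {a b : A⟦X⟧}
    (hu : (u : A⟦X⟧) = 1 + X ^ (m + 1) * a) (hv : (v : A⟦X⟧) = 1 + X ^ (n + 1) * b) :
    ∃ c : A⟦X⟧, ((⁅u, v⁆ : A⟦X⟧ˣ) : A⟦X⟧) = 1 + X ^ (m + n + 1 + 1) * c ∧
      constantCoeff c = ⁅constantCoeff a, constantCoeff b⁆ := by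
  refine ⟨(a * b - b * a) * (((v * u)⁻¹ : A⟦X⟧ˣ) : A⟦X⟧), ?_, ?_⟩
  · have h : (u : A⟦X⟧) * (v : A⟦X⟧) - (v : A⟦X⟧) * (u : A⟦X⟧) =
        X ^ (m + n + 1 + 1) * (a * b - b * a) := by
      have h1 := X_pow_mul_mul_X_pow_mul (m + 1) (n + 1) a b
      have h2 := X_pow_mul_mul_X_pow_mul (n + 1) (m + 1) b a
      rw [show n + 1 + (m + 1) = m + n + 1 + 1 by ring] at h2
      rw [show m + 1 + (n + 1) = m + n + 1 + 1 by ring] at h1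
      rw [hu, hv, mul_sub, ← h1, ← h2]
      noncomm_ring
    have h3 : ⁅u, v⁆ = u * v * (v * u)⁻¹ := by
      rw [commutatorElement_def]; group
    rw [← mul_assoc, ← h, sub_mul, h3]
    simp only [← Units.val_mul, mul_inv_cancel, Units.val_one]
    abel
  · have hcu : constantCoeff (u : A⟦X⟧) = 1 := by simp [hu]
    have hcv : constantCoeff (v : A⟦X⟧) = 1 := by simp [hv]
    have h4 : constantCoeff (((v * u)⁻¹ : A⟦X⟧ˣ) : A⟦X⟧) = 1 := by
      have := congrArg (constantCoeff (R := A)) (Units.mul_inv (v * u))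
      simpa [hcu, hcv] using this
    rw [map_mul, h4, mul_one, map_sub, map_mul, map_mul, LieRing.of_associative_ring_bracket]

theorem coeff_one_add_X_pow_mul (n : ℕ) (a : A⟦X⟧) :
    coeff (n + 1) (1 + X ^ (n + 1) * a) = constantCoeff a := by
  rw [map_add]
  have := coeff_X_pow_mul a (n + 1) 0
  rw [zero_add] at this
  simp [this, coeff_one]

theorem coeff_mul_of_eq {m : ℕ} {u v a b : A⟦X⟧}
    (hu : u = 1 + X ^ (m + 1) * a) (hv : v = 1 + X ^ (m + 1) * b) :
    coeff (m + 1) (u * v) = coeff (m + 1) u + coeff (m + 1) v := by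
  have h : u * v = 1 + X ^ (m + 1) * (a + b + X ^ (m + 1) * (a * b)) := by
    rw [mul_add, ← mul_assoc, ← pow_add, ← X_pow_mul_mul_X_pow_mul, hu, hv]
    noncomm_ring
  rw [h, hu, hv]
  simp [coeff_one_add_X_pow_mul]

theorem exists_eq_of_mem_lcs {G : Type*} [Group G] (μ : G →* A⟦X⟧ˣ)
    (h0 : ∀ g, ∃ a : A⟦X⟧, (μ g : A⟦X⟧) = 1 + X * a) :
    ∀ (m : ℕ) (g : G), g ∈ lcs G m → ∃ a : A⟦X⟧, (μ g : A⟦X⟧) = 1 + X ^ (m + 1) * a := by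
  have hmul : ∀ (m : ℕ) (g h : G), (∃ a : A⟦X⟧, (μ g : A⟦X⟧) = 1 + X ^ (m + 1) * a) →
      (∃ a : A⟦X⟧, (μ h : A⟦X⟧) = 1 + X ^ (m + 1) * a) →
      ∃ a : A⟦X⟧, (μ (g * h) : A⟦X⟧) = 1 + X ^ (m + 1) * a := by
    rintro m g h ⟨a, ha⟩ ⟨b, hb⟩
    refine ⟨a + b + a * (X ^ (m + 1) * b), ?_⟩
    rw [map_mul, Units.val_mul, ha, hb]
    noncomm_ring
  have hinv : ∀ (m : ℕ) (g : G), (∃ a : A⟦X⟧, (μ g : A⟦X⟧) = 1 + X ^ (m + 1) * a) →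
      ∃ a : A⟦X⟧, (μ g⁻¹ : A⟦X⟧) = 1 + X ^ (m + 1) * a := by
    rintro m g ⟨a, ha⟩
    refine ⟨-(a * ((μ g)⁻¹ : A⟦X⟧ˣ)), ?_⟩
    have h := Units.mul_inv (μ g)
    rw [ha, add_mul, one_mul] at h
    rw [map_inv, mul_neg, ← mul_assoc, ← h]
    abel
  intro m
  induction m with
  | zero => intro g _; simpa using h0 g
  | succ m ih =>
    intro g hg
    refine Subgroup.closure_induction
      (p := fun g _ => ∃ a : A⟦X⟧, (μ g : A⟦X⟧) = 1 + X ^ (m + 1 + 1) * a)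
      ?_ ⟨0, by simp⟩ (fun g h _ _ => hmul _ g h) (fun g _ => hinv _ g) hg
    rintro _ ⟨p, hp, q, -, rfl⟩
    obtain ⟨a, ha⟩ := ih p hp
    obtain ⟨b, hb⟩ := h0 q
    obtain ⟨c, hc, -⟩ := exists_commutatorElement_eq (n := 0) ha (by simpa using hb)
    exact ⟨c, by rw [map_commutatorElement, hc]⟩

/-- A representation of `G` by power series with constant term `1` induces, through leading
coefficients, a homomorphism of Lie rings from `gr_*(G)` to the coefficient ring. -/
theorem exists_lieHom_gr [Algebra ℤ A] {G : Type*} [Group G] (μ : G →* A⟦X⟧ˣ)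
    (h0 : ∀ g, ∃ a : A⟦X⟧, (μ g : A⟦X⟧) = 1 + X * a) :
    ∃ ψ : Gr G →ₗ⁅ℤ⁆ A, ∀ (m : ℕ) (g : lcs G m),
      ψ (of m (DescendingCentralSeries.mk m g)) = coeff (m + 1) (μ g : A⟦X⟧) := by
  have hlcs := exists_eq_of_mem_lcs μ h0
  let ℓ : ∀ m, GrPiece G m →+ A := fun m => MonoidHom.toAdditiveLeft <|
    QuotientGroup.lift _
      { toFun := fun g : lcs G m => Multiplicative.ofAdd (coeff (m + 1) (μ g : A⟦X⟧))
        map_one' := by simp [coeff_one]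
        map_mul' := fun g h => by
          obtain ⟨a, ha⟩ := hlcs m g g.2
          obtain ⟨b, hb⟩ := hlcs m h h.2
          rw [Subgroup.coe_mul, map_mul, Units.val_mul, coeff_mul_of_eq ha hb, ofAdd_add] }
      (fun g hg => by
        obtain ⟨a, ha⟩ := hlcs (m + 1) g hg
        change Multiplicative.ofAdd _ = 1
        rw [ha, pow_succ, mul_assoc, coeff_one_add_X_pow_mul]
        simp)
  let ψ : Gr G →+ A := DirectSum.toAddMonoid ℓ
  have hψ : ∀ (m : ℕ) (g : lcs G m),
      ψ (of m (DescendingCentralSeries.mk m g)) = coeff (m + 1) (μ g : A⟦X⟧) := fun m g =>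
    DirectSum.toAddMonoid_of ℓ m _
  refine ⟨{ toFun := ψ, map_add' := map_add ψ, map_smul' := fun n x => ?_,
            map_lie' := fun {x y} => ?_ }, hψ⟩
  · simp [Algebra.smul_def]
  · change ψ (bracketHom x y) = ⁅ψ x, ψ y⁆
    induction x using gr_induction with
    | h0 => simp
    | hadd x x' hx hx' => simp only [map_add, AddMonoidHom.add_apply, add_lie, hx, hx']
    | hof i g =>
      induction y using gr_induction with
      | h0 => simp
      | hadd y y' hy hy' => simp only [map_add, lie_add, hy, hy']
      | hof j h =>
        obtain ⟨a, ha⟩ := hlcs i g g.2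
        obtain ⟨b, hb⟩ := hlcs j h h.2
        obtain ⟨c, hc, hc'⟩ := exists_commutatorElement_eq ha hb
        rw [bracketHom_mk_mk, hψ, hψ, hψ]
        change coeff _ ((μ ⁅(g : G), (h : G)⁆ : A⟦X⟧ˣ) : A⟦X⟧) = _
        rw [map_commutatorElement, hc, ha, hb, coeff_one_add_X_pow_mul, coeff_one_add_X_pow_mul,
          coeff_one_add_X_pow_mul, hc']

end PowerSeries

/-! ### Free groups -/

namespace FreeGroup

variable {α : Type v}

variable (α) in
/-- The unit `1 + x T` of the ring of power series in `T` over the free algebra. The variable `T`,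
which is central, only records the degree. -/
noncomputable def magnusUnit (x : α) : (FreeAlgebra ℤ α)⟦X⟧ˣ where
  val := 1 + X * C (FreeAlgebra.ι ℤ x)
  inv := invOfUnit (1 + X * C (FreeAlgebra.ι ℤ x)) 1
  val_inv := mul_invOfUnit _ _ (by simp)
  inv_val := invOfUnit_mul _ _ (by simp)

variable (α) in
/-- The Magnus representation `x ↦ 1 + x T` of the free group. -/
noncomputable def magnus : FreeGroup α →* (FreeAlgebra ℤ α)⟦X⟧ˣ := FreeGroup.lift (magnusUnit α)

theorem exists_magnus_eq (g : FreeGroup α) :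
    ∃ a, (magnus α g : (FreeAlgebra ℤ α)⟦X⟧) = 1 + X * a := by
  have hc : ∀ g, constantCoeff (magnus α g : (FreeAlgebra ℤ α)⟦X⟧) = 1 := by
    have : (Units.map (constantCoeff (R := FreeAlgebra ℤ α)).toMonoidHom).comp (magnus α) = 1 := by
      ext x
      simp [magnus, magnusUnit]
    intro g
    exact congrArg Units.val (DFunLike.congr_fun this g)
  obtain ⟨a, ha⟩ := (X_dvd_iff (φ := (magnus α g : (FreeAlgebra ℤ α)⟦X⟧) - 1)).2 (by simp [hc])
  exact ⟨a, by rw [← ha]; abel⟩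

/-- The homomorphism from the free Lie ring on `α` to `gr_*` of the free group on `α` that sends a
generator to its class in degree one. -/
noncomputable def freeLieToGr (α : Type v) : FreeLieAlgebra ℤ α →ₗ⁅ℤ⁆ Gr (FreeGroup α) :=
  FreeLieAlgebra.lift ℤ fun x =>
    degreeOne (FreeGroup.of x)

theorem freeLieToGr_of (x : α) : freeLieToGr α (FreeLieAlgebra.of ℤ x) =
    degreeOne (FreeGroup.of x) := by
  unfold freeLieToGr
  rw [FreeLieAlgebra.lift_of_apply]

theorem freeLieToGr_surjective (α : Type v) : Function.Surjective (freeLieToGr α) := by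
  rw [← LieHom.range_eq_top]
  refine eq_top_of_forall_mk_mem (closure_range_of α) ?_
  rintro _ ⟨x, rfl⟩
  exact ⟨_, freeLieToGr_of x⟩

/-- The Magnus representation yields a homomorphism from `gr_*` of the free group to the free
associative algebra that extends the canonical one of the free Lie ring. -/
theorem exists_gr_to_freeAlgebra (α : Type v) : ∃ ψ : Gr (FreeGroup α) →ₗ⁅ℤ⁆ FreeAlgebra ℤ α,
    (∀ x, ψ (degreeOne (FreeGroup.of x)) = FreeAlgebra.ι ℤ x) ∧
      ∀ t, ψ (freeLieToGr α t) = FreeLieAlgebra.toFreeAlgebra ℤ α t := by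
  obtain ⟨ψ, hψ⟩ := exists_lieHom_gr (magnus α) exists_magnus_eq
  have h1 : ∀ x, ψ (degreeOne (FreeGroup.of x)) = FreeAlgebra.ι ℤ x := by
    intro x
    rw [degreeOne, hψ]
    simp [magnus, magnusUnit, coeff_one]
  refine ⟨ψ, h1, fun t => ?_⟩
  have : ψ.comp (freeLieToGr α) = FreeLieAlgebra.toFreeAlgebra ℤ α := by
    apply FreeLieAlgebra.hom_ext
    intro x
    rw [LieHom.comp_apply, freeLieToGr_of, h1, FreeLieAlgebra.toFreeAlgebra_of]
  exact DFunLike.congr_fun this t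

/-- With the surjectivity of `freeLieToGr`, this says that `gr_*` of a free group embeds in the free
associative algebra. -/
theorem freeLieToGr_eq_zero {α : Type v} {t : FreeLieAlgebra ℤ α}
    (ht : FreeLieAlgebra.toFreeAlgebra ℤ α t = 0) : freeLieToGr α t = 0 := by
  have h := fun n => FreeLieAlgebra.lift_mem_of_toFreeAlgebra_eq_zero (L := Gr (FreeGroup α)) grGE
    grGE_antitone (fun i j a b => lie_mem_grGE) (e := fun x => degreeOne (FreeGroup.of x))
    (fun x => of_mem_grGE _ le_rfl) ht n
  exact eq_zero_of_forall_mem_grGE h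

/-- In `gr_*` of a free group of rank at least two, only `0` commutes with the part of degree
one. -/
theorem eq_zero_of_forall_lie_eq_zero {α : Type v} {a b : α} (hab : a ≠ b)
    {u : Gr (FreeGroup α)} (hu : ∀ g : FreeGroup α, ⁅u, degreeOne g⁆ = 0) : u = 0 := by
  obtain ⟨t, rfl⟩ := freeLieToGr_surjective α u
  obtain ⟨ψ, hψ, hψt⟩ := exists_gr_to_freeAlgebra α
  have hcomm : ∀ x, Commute (FreeLieAlgebra.toFreeAlgebra ℤ α t) (FreeAlgebra.ι ℤ x) := by
    intro x
    have := congrArg ψ (hu (FreeGroup.of x))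
    rw [LieHom.map_lie, hψt, hψ, map_zero, LieRing.of_associative_ring_bracket, sub_eq_zero] at this
    exact this
  exact freeLieToGr_eq_zero (FreeAlgebra.eq_zero_of_commute hab (hcomm a) (hcomm b)
    (FreeLieAlgebra.algebraMapInv_toFreeAlgebra t))

theorem center_eq_bot {α : Type v} {a b : α} (hab : a ≠ b) :
    Subgroup.center (FreeGroup α) = ⊥ := by
  classical
  rw [eq_bot_iff]
  intro z hz
  rw [Subgroup.mem_bot]
  by_contra hz1
  have hw : z.toWord ≠ [] := by rwa [Ne, toWord_eq_nil_iff]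
  obtain ⟨p, l, hpl⟩ := List.exists_cons_of_ne_nil hw
  obtain ⟨l', q, hlq⟩ := List.eq_nil_or_concat z.toWord |>.resolve_left hw
  obtain ⟨d, hd⟩ : ∃ d, d ≠ p.1 := by
    by_cases h : a = p.1
    · exact ⟨b, by rw [← h]; exact hab.symm⟩
    · exact ⟨a, h⟩
  -- conjugating `z` by this letter lengthens its reduced word by two
  have hred : IsReduced ((d, !q.2) :: z.toWord ++ [(d, q.2)]) := by
    have h1 : IsReduced ((d, !q.2) :: z.toWord) := by
      rw [hpl, isReduced_cons_cons, ← hpl]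
      exact ⟨fun h => absurd h hd, isReduced_toWord⟩
    have h2 : IsReduced (z.toWord ++ [(d, q.2)]) := by
      have hz := isReduced_toWord (x := z)
      unfold IsReduced at hz ⊢
      rw [List.isChain_append]
      refine ⟨hz, List.isChain_singleton _, ?_⟩
      simp [hlq]
    exact IsReduced.append_overlap (L₁ := [(d, !q.2)]) h1 h2 hw
  have hmk : FreeGroup.mk ((d, !q.2) :: z.toWord ++ [(d, q.2)]) = z := by
    have h3 : FreeGroup.mk ((d, !q.2) :: z.toWord ++ [(d, q.2)]) =
        FreeGroup.mk [(d, !q.2)] * z * FreeGroup.mk [(d, q.2)] := by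
      conv_rhs => rw [← mk_toWord (x := z), mul_mk, mul_mk]
      rfl
    have h4 : FreeGroup.mk [(d, !q.2)] = (FreeGroup.mk [(d, q.2)])⁻¹ := by
      simp [inv_mk, invRev]
    rw [h3, h4, mul_assoc, ← Subgroup.mem_center_iff.1 hz, inv_mul_cancel_left]
  have hlen := congrArg (fun g => g.toWord.length) hmk
  simp only [toWord_mk, hred.reduce_eq] at hlen
  simp at hlen
  omega

end FreeGroup
end Magnus

/-! ### Trivial action on the first homology group of the kernel -/

section Homology

open CategoryTheory groupHomology

/-- An endomorphism that acts trivially on `H_1(N; ℤ)` acts trivially on `Nᵃᵇ`, as `H_1(N; ℤ)` is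
naturally `Nᵃᵇ ⊗ ℤ`. -/
theorem abelianization_of_eq_of_integralHomologyMap_eq_id {N : Type u} [Group N] (f : N →* N)
    (h : integralHomologyMap f 1 = 𝟙 _) (x : N) :
    Abelianization.of (f x) = Abelianization.of x := by
  have h1 := congrArg (fun g => g.hom (H1π (trivialIntRep N)
    ((cycles₁IsoOfIsTrivial _).inv (Finsupp.single x ⟨1⟩)))) h
  unfold integralHomologyMap at h1
  dsimp only at h1
  erw [H1π_comp_map_apply] at h1
  have h2 : mapCycles₁ f (trivialIntRepHom f)
        ((cycles₁IsoOfIsTrivial _).inv (Finsupp.single x ⟨1⟩)) =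
      (cycles₁IsoOfIsTrivial (trivialIntRep N)).inv (Finsupp.single (f x) ⟨1⟩) := by
    apply Subtype.ext
    rw [coe_mapCycles₁]
    have hc : ∀ x : N, ((cycles₁IsoOfIsTrivial (trivialIntRep N)).inv (Finsupp.single x ⟨1⟩)).1 =
        Finsupp.single x ⟨1⟩ := fun _ => rfl
    simp only [chainsMap₁, ModuleCat.hom_ofHom, LinearMap.comp_apply]
    erw [hc, hc]
    simp only [Finsupp.lmapDomain_apply, Finsupp.mapRange.linearMap_apply,
      Finsupp.mapDomain_single, Finsupp.mapRange_single]
    rfl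
  rw [h2] at h1
  have h3 := congrArg (H1AddEquivOfIsTrivial (trivialIntRep N)) h1
  erw [H1AddEquivOfIsTrivial_single, H1AddEquivOfIsTrivial_single] at h3
  -- contract `Nᵃᵇ ⊗ ℤ` to `Nᵃᵇ`
  have h4 := congrArg (TensorProduct.lift (R := ℤ) (M := Additive (Abelianization N))
    (N := ULift.{u} ℤ) (P₂ := Additive (Abelianization N))
    (((LinearMap.lsmul ℤ (Additive (Abelianization N))).comp
      ULift.moduleEquiv.toLinearMap).flip)) h3
  simpa using h4

theorem ActsTriviallyOnKernelHomology.commutator_ker_top_le {G Q : Type u} [Group G] [Group Q]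
    {p : G →* Q} (h : ActsTriviallyOnKernelHomology p) : ⁅p.ker, ⊤⁆ ≤ ⁅p.ker, p.ker⁆ := by
  rw [Subgroup.commutator_comm, Subgroup.commutator_le]
  rintro g - x hx
  have h1 := abelianization_of_eq_of_integralHomologyMap_eq_id _ (h (p g) g rfl 1) ⟨x, hx⟩
  have h2 : MulAut.conjNormal (H := p.ker) g ⟨x, hx⟩ * (⟨x, hx⟩ : p.ker)⁻¹ ∈ commutator p.ker := by
    rw [← Abelianization.ker_of, MonoidHom.mem_ker, map_mul, map_inv]
    exact mul_inv_eq_one.2 h1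
  have h3 := Subgroup.mem_map_of_mem p.ker.subtype h2
  rw [commutator, Subgroup.map_commutator, ← MonoidHom.range_eq_map, Subgroup.range_subtype] at h3
  simpa [commutatorElement_def] using h3

end Homology

/-! ### The descending central series of a split extension -/

namespace DescendingCentralSeries

open scoped commutatorElement

section FalkRandell

variable {G : Type u} [Group G] {K : Subgroup G}

instance normal_lowerCentralSeries [K.Normal] (n : ℕ) : (K.lowerCentralSeries n).Normal := by
  induction n with
  | zero => assumption
  | succ n ih => exact Subgroup.commutator_normal _ _

/-- If `G` acts trivially on `Kᵃᵇ`, it acts trivially on all successive quotients of the descending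
central series of `K`. -/
theorem commutator_lowerCentralSeries_top_le [K.Normal]
    (h : ⁅K, (⊤ : Subgroup G)⁆ ≤ ⁅K, K⁆) (k : ℕ) :
    ⁅K.lowerCentralSeries k, (⊤ : Subgroup G)⁆ ≤ K.lowerCentralSeries (k + 1) := by
  induction k with
  | zero => exact h
  | succ k ih =>
    apply commutator_commutator_le_of_rotate
    · refine (Subgroup.commutator_mono h le_rfl).trans ?_
      apply commutator_commutator_le_of_rotate
      · rw [Subgroup.commutator_comm K]
        exact le_rfl
      · exact le_rfl
    · rw [Subgroup.commutator_comm ⊤]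
      exact Subgroup.commutator_mono ih le_rfl

theorem commutator_lcs_lowerCentralSeries_le [K.Normal]
    (h : ⁅K, (⊤ : Subgroup G)⁆ ≤ ⁅K, K⁆) (m k : ℕ) :
    ⁅lcs G m, K.lowerCentralSeries k⁆ ≤ K.lowerCentralSeries (m + k + 1) := by
  induction m generalizing k with
  | zero =>
    rw [Subgroup.commutator_comm, Nat.zero_add]
    exact commutator_lowerCentralSeries_top_le h k
  | succ m ih =>
    apply commutator_commutator_le_of_rotate (lcs G m) ⊤
    · rw [Subgroup.commutator_comm ⊤, Subgroup.commutator_comm _ (lcs G m)]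
      refine (Subgroup.commutator_mono le_rfl (commutator_lowerCentralSeries_top_le h k)).trans ?_
      refine (ih (k + 1)).trans_eq ?_
      congr 1
      ring
    · rw [Subgroup.commutator_comm _ (lcs G m)]
      refine (Subgroup.commutator_mono (ih k) le_rfl).trans
        ((commutator_lowerCentralSeries_top_le h _).trans_eq ?_)
      congr 1
      ring

theorem map_mem_lcs {G Q : Type*} [Group G] [Group Q] (f : G →* Q) {m : ℕ} {x : G}
    (hx : x ∈ lcs G m) : f x ∈ lcs Q m := by
  have h := Subgroup.mem_map_of_mem f hx
  rw [Subgroup.map_lowerCentralSeries] at h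
  exact Subgroup.lowerCentralSeries_mono m le_top h

/-- Let `K` be the kernel of a split epimorphism `p` from `G`, with section `s`. If `G` acts
trivially on `Kᵃᵇ`, then `G_m = K_m · s(Q_m)`; in particular `G_m ∩ K = K_m` (Falk and Randell). -/
theorem mul_inv_section_mem {Q : Type u} [Group Q] {p : G →* Q} {s : Q →* G}
    (hs : p.comp s = MonoidHom.id Q) (h : ⁅p.ker, (⊤ : Subgroup G)⁆ ≤ ⁅p.ker, p.ker⁆) (m : ℕ) :
    ∀ x ∈ lcs G m, x * (s (p x))⁻¹ ∈ p.ker.lowerCentralSeries m := by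
  have hps : ∀ q, p (s q) = q := DFunLike.congr_fun hs
  have hK : ∀ x, x * (s (p x))⁻¹ ∈ p.ker := fun x => by simp [MonoidHom.mem_ker, hps]
  induction m with
  | zero => exact fun x _ => hK x
  | succ m ih =>
    set N := p.ker.lowerCentralSeries (m + 1)
    let π := QuotientGroup.mk' N
    have hcomm : ∀ {x y : G}, ⁅x, y⁆ ∈ N → Commute (π x) (π y) := fun {x y} hxy => by
      rw [← commutatorElement_eq_one_iff_commute, ← map_commutatorElement]
      exact (QuotientGroup.eq_one_iff _).2 hxy
    -- modulo `N`, the homomorphisms `x ↦ x` and `x ↦ s (p x)` agree on commutators `⁅x, y⁆` with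
    -- `x` in the previous stage: `f` is central, and `g` commutes with `s (p x)` and with
    -- `⁅s (p x), s (p y)⁆`
    have hle : lcs G (m + 1) ≤ π.eqLocus ((π.comp s).comp p) := by
      refine Subgroup.commutator_le.2 ?_
      rintro x hx y -
      change π ⁅x, y⁆ = π (s (p ⁅x, y⁆))
      have ha : s (p x) ∈ lcs G m := map_mem_lcs s (map_mem_lcs p hx)
      obtain ⟨f, hf, hfx⟩ : ∃ f ∈ p.ker.lowerCentralSeries m, x = f * s (p x) :=
        ⟨_, ih x hx, by group⟩
      obtain ⟨g, hg, hgy⟩ : ∃ g ∈ p.ker, y = g * s (p y) := ⟨_, hK y, by group⟩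
      have hfc : ∀ z, Commute (π f) (π z) := fun z => hcomm
        (commutator_lowerCentralSeries_top_le h m
          (Subgroup.commutator_mem_commutator hf (Subgroup.mem_top z)))
      have hag : Commute (π (s (p x))) (π g) := hcomm
        (commutator_lcs_lowerCentralSeries_le h m 0 (Subgroup.commutator_mem_commutator ha hg))
      have hcg : Commute (π ⁅s (p x), s (p y)⁆) (π g) := hcomm
        (Subgroup.lowerCentralSeries_antitone _ (Nat.le_succ _)
          (commutator_lcs_lowerCentralSeries_le h (m + 1) 0 (Subgroup.commutator_mem_commutator
            (Subgroup.commutator_mem_commutator ha (Subgroup.mem_top _)) hg)))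
      calc π ⁅x, y⁆ = ⁅π f * π (s (p x)), π y⁆ := by
            rw [map_commutatorElement, ← map_mul, ← hfx]
        _ = ⁅π (s (p x)), π y⁆ := by
            have h1 : π f * π y * (π f)⁻¹ = π y := by rw [(hfc y).eq, mul_inv_cancel_right]
            rw [(hfc _).eq, commutatorElement_def, commutatorElement_def]
            nth_rewrite 3 [← h1]
            group
        _ = π g * ⁅π (s (p x)), π (s (p y))⁆ * (π g)⁻¹ := by
            have h1 : π y = π g * π (s (p y)) := by rw [← map_mul, ← hgy]
            rw [commutatorElement_def, commutatorElement_def, h1, ← mul_assoc, hag.eq]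
            group
        _ = π (s (p ⁅x, y⁆)) := by
            rw [← map_commutatorElement, ← hcg.eq, mul_inv_cancel_right, ← map_commutatorElement s,
              ← map_commutatorElement p]
    intro x hx
    have h1 : π x = π (s (p x)) := hle hx
    rw [← QuotientGroup.eq_one_iff (N := N)]
    change π (x * (s (p x))⁻¹) = 1
    rw [map_mul, map_inv, h1, mul_inv_cancel]

end FalkRandell

end DescendingCentralSeries

/-! ### Functoriality of the Lie ring, and its center -/

namespace DescendingCentralSeries

open scoped commutatorElement DirectSum

section Functoriality

variable {G Q : Type u} [Group G] [Group Q]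

/-- The map induced on `G_{i+1} / G_{i+2}` by a group homomorphism. -/
def pieceMap (p : G →* Q) (i : ℕ) : GrPiece G i →+ GrPiece Q i :=
  MonoidHom.toAdditive <| QuotientGroup.map _ _
    ((p.comp (lcs G i).subtype).codRestrict (lcs Q i) fun x => map_mem_lcs p x.2)
    fun x hx => show p x ∈ lcs Q (i + 1) from map_mem_lcs p hx

theorem pieceMap_mk (p : G →* Q) (i : ℕ) (x : lcs G i) :
    pieceMap p i (mk i x) = mk i ⟨p x, map_mem_lcs p x.2⟩ := rfl

/-- The additive map `gr_*(G) → gr_*(Q)` induced by a group homomorphism. -/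
noncomputable def grMap (p : G →* Q) : Gr G →+ Gr Q := DirectSum.map (pieceMap p)

theorem grMap_of_mk (p : G →* Q) (i : ℕ) (x : lcs G i) :
    grMap p (of i (mk i x)) = of i (mk i ⟨p x, map_mem_lcs p x.2⟩) :=
  (DirectSum.map_of (pieceMap p) i _).trans rfl

theorem comp_grMap (p : G →* Q) (i : ℕ) (z : Gr G) :
    comp i (grMap p z) = pieceMap p i (comp i z) :=
  DirectSum.map_apply (pieceMap p) i z

theorem grMap_lie (p : G →* Q) (a b : Gr G) : grMap p ⁅a, b⁆ = ⁅grMap p a, grMap p b⁆ := by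
  induction a using gr_induction with
  | h0 => simp
  | hadd a a' ha ha' => simp only [map_add, add_lie, ha, ha']
  | hof i x =>
    induction b using gr_induction with
    | h0 => simp
    | hadd b b' hb hb' => simp only [map_add, lie_add, hb, hb']
    | hof j y =>
      rw [bracket_def, bracketHom_mk_mk, grMap_of_mk, grMap_of_mk, grMap_of_mk, bracket_def,
        bracketHom_mk_mk]
      congr 2
      ext
      exact map_commutatorElement p _ _

theorem grMap_surjective {p : G →* Q} {s : Q →* G} (hs : p.comp s = MonoidHom.id Q) :
    Function.Surjective (grMap p) := by
  intro z
  induction z using gr_induction with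
  | h0 => exact ⟨0, map_zero _⟩
  | hof i x =>
    refine ⟨of i (mk i ⟨s x, map_mem_lcs s x.2⟩), ?_⟩
    rw [grMap_of_mk]
    congr 2
    ext
    exact DFunLike.congr_fun hs (x : Q)
  | hadd a b ha hb =>
    obtain ⟨a, rfl⟩ := ha
    obtain ⟨b, rfl⟩ := hb
    exact ⟨a + b, map_add _ _ _⟩

theorem mem_center_gr_iff {z : Gr G} : z ∈ LieAlgebra.center ℤ (Gr G) ↔ ∀ a : Gr G, ⁅z, a⁆ = 0 := by
  rw [LieModule.mem_maxTrivSubmodule]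
  refine forall_congr' fun a => ?_
  rw [← lie_skew, neg_eq_zero]

theorem grMap_mem_center {p : G →* Q} {s : Q →* G} (hs : p.comp s = MonoidHom.id Q) {z : Gr G}
    (hz : z ∈ LieAlgebra.center ℤ (Gr G)) : grMap p z ∈ LieAlgebra.center ℤ (Gr Q) := by
  rw [mem_center_gr_iff] at hz ⊢
  intro a
  obtain ⟨a, rfl⟩ := grMap_surjective hs a
  rw [← grMap_lie, hz, map_zero]

theorem of_comp_lie_degreeOne (z : Gr G) (i : ℕ) (y : G) :
    ⁅of i (comp i z), degreeOne y⁆ = of (i + 1) (comp (i + 1) ⁅z, degreeOne y⁆) := by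
  induction z using gr_induction with
  | h0 => simp
  | hadd a b ha hb => simp only [map_add, add_lie, ha, hb]
  | hof j x =>
    by_cases h : j = i
    · subst h
      rw [comp_of_self, degreeOne, bracket_def, bracketHom_mk_mk]
      exact congrArg _ (comp_of_self _ _).symm
    · rw [comp_of_ne h, map_zero, zero_lie, degreeOne, bracket_def, bracketHom_mk_mk,
        comp_of_ne (by omega), map_zero]

/-- The homogeneous components of a central element commute with the part of degree one. -/
theorem commutator_mem_of_mem_center {z : Gr G} (hz : z ∈ LieAlgebra.center ℤ (Gr G)) {i : ℕ}
    {x : lcs G i} (hx : comp i z = mk i x) (y : G) : ⁅(x : G), y⁆ ∈ lcs G (i + 2) := by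
  have h := of_comp_lie_degreeOne z i y
  rw [mem_center_gr_iff.1 hz, map_zero, map_zero, hx, degreeOne, bracket_def, bracketHom_mk_mk,
    of_mk_eq_zero_iff] at h
  exact h

end Functoriality

/-! ### Centers of split extensions with free kernel -/

section FreeKernel

variable {G : Type u} [Group G]

/-- For a free subgroup `K` of rank at least two, an element of `K_m` whose commutators with `K`
lie in `K_{m+2}` is itself in `K_{m+1}`. -/
theorem mem_lowerCentralSeries_succ_of_free {α : Type v} {a b : α} (hab : a ≠ b) {K : Subgroup G}
    (e : FreeGroup α ≃* K) {i : ℕ} {f : G} (hf : f ∈ K.lowerCentralSeries i)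
    (h : ∀ y ∈ K, ⁅f, y⁆ ∈ K.lowerCentralSeries (i + 2)) : f ∈ K.lowerCentralSeries (i + 1) := by
  let φ : FreeGroup α →* G := K.subtype.comp e.toMonoidHom
  have hφ : Function.Injective φ := Subtype.val_injective.comp e.injective
  have hmap : ∀ n, (lcs (FreeGroup α) n).map φ = K.lowerCentralSeries n := by
    intro n
    have : (⊤ : Subgroup (FreeGroup α)).map φ = K := by
      rw [← MonoidHom.range_eq_map]
      ext x
      refine ⟨?_, fun hx => ⟨e.symm ⟨x, hx⟩, by simp [φ]⟩⟩
      rintro ⟨y, rfl⟩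
      exact (e y).2
    rw [Subgroup.map_lowerCentralSeries, this]
  rw [← hmap] at hf ⊢
  obtain ⟨f, hf, rfl⟩ := hf
  refine Subgroup.mem_map_of_mem φ ?_
  have h0 := FreeGroup.eq_zero_of_forall_lie_eq_zero hab (u := of i (mk i ⟨f, hf⟩)) fun y => by
    rw [degreeOne, bracket_def, bracketHom_mk_mk, of_mk_eq_zero_iff]
    have h1 := h (φ y) (e y).2
    rw [← hmap, ← map_commutatorElement] at h1
    exact (Subgroup.mem_map_iff_mem hφ).1 h1
  exact (of_mk_eq_zero_iff _).1 h0

end FreeKernel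

section Extension

variable {G Q : Type u} [Group G] [Group Q] {p : G →* Q} {s : Q →* G}
  {α : Type v} {a b : α}

/-- The projection `gr_*(G) → gr_*(Q)` is injective on the center: a central element that it
annihilates has homogeneous components in `gr_*` of the kernel, whose center is trivial. -/
theorem eq_zero_of_mem_center_of_grMap_eq_zero (hs : p.comp s = MonoidHom.id Q)
    (h : ⁅p.ker, (⊤ : Subgroup G)⁆ ≤ ⁅p.ker, p.ker⁆) (hab : a ≠ b) (e : FreeGroup α ≃* p.ker)
    {z : Gr G} (hz : z ∈ LieAlgebra.center ℤ (Gr G)) (hpz : grMap p z = 0) : z = 0 := by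
  refine ext_comp fun i => ?_
  obtain ⟨x, hx⟩ : ∃ x : lcs G i, comp i z = mk i x := by
    obtain ⟨x, hx⟩ := QuotientGroup.mk_surjective (comp i z).toMul
    exact ⟨x, congrArg Additive.ofMul hx.symm⟩
  have hpx : p x ∈ lcs Q (i + 1) := by
    have h1 := comp_grMap p i z
    rw [hpz, map_zero, hx, pieceMap_mk] at h1
    refine (of_mk_eq_zero_iff ⟨p x, map_mem_lcs p x.2⟩).1 ?_
    rw [← h1, map_zero]
  -- the class of `x` is represented by an element `f` of the kernel
  set t := s (p x)
  have ht' : t ∈ lcs G (i + 1) := map_mem_lcs s hpx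
  set f := (x : G) * t⁻¹
  have hfK : f ∈ p.ker.lowerCentralSeries i := mul_inv_section_mem hs h i x x.2
  have hfl : f ∈ lcs G i := Subgroup.lowerCentralSeries_mono i le_top hfK
  have hxf : mk i x = mk i ⟨f, hfl⟩ := by
    refine congrArg Additive.ofMul ((mkMul_eq_iff i x ⟨f, hfl⟩).2 ?_)
    change (x : G)⁻¹ * (x * t⁻¹) ∈ lcs G (i + 1)
    rw [inv_mul_cancel_left]
    exact inv_mem ht'
  have hmem : f ∈ p.ker.lowerCentralSeries (i + 1) := by
    refine mem_lowerCentralSeries_succ_of_free hab e hfK fun y hy => ?_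
    have h1 : ⁅f, y⁆ ∈ lcs G (i + 2) := commutator_mem_of_mem_center hz (hx.trans hxf) y
    have h2 := mul_inv_section_mem hs h (i + 2) _ h1
    have h3 : p ⁅f, y⁆ = 1 := by
      rw [map_commutatorElement, MonoidHom.mem_ker.1 hy, commutatorElement_one_right]
    rwa [h3, map_one, inv_one, mul_one] at h2
  have h4 : of i (mk i ⟨f, hfl⟩) = 0 :=
    (of_mk_eq_zero_iff _).2 (Subgroup.lowerCentralSeries_mono (i + 1) le_top hmem)
  rw [hx, hxf, ← comp_of_self i (mk i _), h4]

theorem isAddCyclic_center_gr (hs : p.comp s = MonoidHom.id Q)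
    (h : ⁅p.ker, (⊤ : Subgroup G)⁆ ≤ ⁅p.ker, p.ker⁆) (hab : a ≠ b) (e : FreeGroup α ≃* p.ker)
    (hQ : IsAddCyclic (LieAlgebra.center ℤ (Gr Q))) :
    IsAddCyclic (LieAlgebra.center ℤ (Gr G)) := by
  let F : LieAlgebra.center ℤ (Gr G) →+ LieAlgebra.center ℤ (Gr Q) :=
    { toFun := fun z => ⟨grMap p z, grMap_mem_center hs z.2⟩
      map_zero' := by ext; simp
      map_add' := fun x y => by ext; simp }
  refine isAddCyclic_of_injective F ((injective_iff_map_eq_zero F).2 fun z hz => Subtype.ext ?_)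
  exact eq_zero_of_mem_center_of_grMap_eq_zero hs h hab e z.2 (congrArg Subtype.val hz)

theorem center_gr_eq_bot (hs : p.comp s = MonoidHom.id Q)
    (h : ⁅p.ker, (⊤ : Subgroup G)⁆ ≤ ⁅p.ker, p.ker⁆) (hab : a ≠ b) (e : FreeGroup α ≃* p.ker)
    (hQ : LieAlgebra.center ℤ (Gr Q) = ⊥) : LieAlgebra.center ℤ (Gr G) = ⊥ := by
  rw [eq_bot_iff]
  intro z hz
  have := grMap_mem_center hs hz
  rw [hQ, LieSubmodule.mem_bot] at this
  exact eq_zero_of_mem_center_of_grMap_eq_zero hs h hab e hz this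

theorem center_eq_bot_of_free_ker (hs : p.comp s = MonoidHom.id Q) (hab : a ≠ b)
    (e : FreeGroup α ≃* p.ker) (hQ : Subgroup.center Q = ⊥) : Subgroup.center G = ⊥ := by
  rw [eq_bot_iff]
  intro z hz
  have hpz : p z ∈ Subgroup.center Q := by
    rw [Subgroup.mem_center_iff]
    intro q
    have hq : p (s q) = q := DFunLike.congr_fun hs q
    rw [← hq, ← map_mul, ← map_mul, Subgroup.mem_center_iff.1 hz]
  rw [hQ, Subgroup.mem_bot] at hpz
  have h1 : e.symm ⟨z, hpz⟩ ∈ Subgroup.center (FreeGroup α) := by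
    rw [Subgroup.mem_center_iff]
    intro g
    apply e.injective
    ext
    simpa using Subgroup.mem_center_iff.1 hz (e g)
  rw [FreeGroup.center_eq_bot hab, Subgroup.mem_bot] at h1
  have h2 : (⟨z, hpz⟩ : p.ker) = 1 := by simpa using h1
  exact congrArg Subtype.val h2

end Extension

/-! ### Free groups as the base of the tower -/

section Base

theorem isAddCyclic_gr_of_isCyclic {G : Type u} [Group G] [IsCyclic G] : IsAddCyclic (Gr G) := by
  have hlcs : ∀ i, lcs G (i + 1) = ⊥ := by
    intro i
    rw [eq_bot_iff]
    refine Subgroup.commutator_le.2 fun x _ y _ => ?_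
    rw [Subgroup.mem_bot, commutatorElement_eq_one_iff_mul_comm]
    exact (IsCyclic.commGroup (α := G)).mul_comm x y
  let F : Additive G →+ Gr G :=
    { toFun := fun g => degreeOne g.toMul
      map_zero' := of_mk_one 0
      map_add' := fun x y => of_mk_mul 0 ⟨x.toMul, mem_lcs_zero _⟩ ⟨y.toMul, mem_lcs_zero _⟩ }
  refine isAddCyclic_of_surjective F fun z => ?_
  induction z using gr_induction with
  | h0 => exact ⟨0, map_zero F⟩
  | hof i x =>
    cases i with
    | zero => exact ⟨Additive.ofMul (x : G), rfl⟩
    | succ i =>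
      refine ⟨0, ?_⟩
      rw [map_zero, eq_comm, of_mk_eq_zero_iff]
      have : (x : G) = 1 := (Subgroup.mem_bot).1 ((hlcs i).le x.2)
      rw [this]
      exact one_mem _
  | hadd a b ha hb =>
    obtain ⟨a, rfl⟩ := ha
    obtain ⟨b, rfl⟩ := hb
    exact ⟨a + b, map_add _ _ _⟩

theorem centers_eq_bot_of_free {G : Type u} [Group G] {α : Type v} {a b : α} (hab : a ≠ b)
    (e : FreeGroup α ≃* G) : LieAlgebra.center ℤ (Gr G) = ⊥ ∧ Subgroup.center G = ⊥ := by
  -- a free group is an extension of the trivial group by itself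
  let p : G →* PUnit.{u + 1} := 1
  let s : PUnit.{u + 1} →* G := 1
  have hs : p.comp s = MonoidHom.id _ := by ext
  have hp : p.ker = ⊤ := MonoidHom.ker_one
  have e' : FreeGroup α ≃* p.ker :=
    e.trans (Subgroup.topEquiv.symm.trans (MulEquiv.subgroupCongr hp.symm))
  refine ⟨center_gr_eq_bot hs (by rw [hp]) hab e' ?_, center_eq_bot_of_free_ker hs hab e' ?_⟩
  · rw [eq_bot_iff]
    rintro z -
    rw [LieSubmodule.mem_bot]
    refine ext_comp fun i => ?_
    obtain ⟨x, hx⟩ := QuotientGroup.mk_surjective (comp i z).toMul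
    have h1 : comp i z = mk i x := congrArg Additive.ofMul hx.symm
    rw [h1, Subsingleton.elim x 1]
    rfl
  · exact Subsingleton.elim _ _

theorem _root_.FreeGroup.isCyclic_of_subsingleton (α : Type v) [Subsingleton α] :
    IsCyclic (FreeGroup α) := by
  have h := FreeGroup.closure_range_of α
  rcases isEmpty_or_nonempty α with _ | ⟨⟨x⟩⟩
  · infer_instance
  · refine ⟨FreeGroup.of x, fun g => ?_⟩
    have h2 : Set.range (FreeGroup.of (α := α)) = {FreeGroup.of x} := by
      ext y
      refine ⟨?_, fun hy => ⟨x, hy.symm⟩⟩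
      rintro ⟨z, rfl⟩
      rw [Subsingleton.elim z x]
      rfl
    rw [h2, ← Subgroup.zpowers_eq_closure] at h
    exact Subgroup.mem_zpowers_iff.1 (h ▸ Subgroup.mem_top g)

end Base

end DescendingCentralSeries

open DescendingCentralSeries in
theorem proposition2p1 (n : ℕ)
    -- the groups `Γ 0, …, Γ n` and the projections `p k : Γ (k + 1) → Γ k` for `k < n`;
    -- nothing is assumed about the groups and maps beyond these
    (Γ : ℕ → Type u) [∀ k, Group (Γ k)] (p : ∀ k, Γ (k + 1) →* Γ k)
    -- the free generating sets of the free groups of the tower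
    (α : ℕ → Type v)
    -- `Γ 0` is free on `α 0`
    (hzero : Nonempty (FreeGroup (α 0) ≃* Γ 0))
    -- the kernel of `Γ (k + 1) → Γ k` is free on `α (k + 1)`
    (hker : ∀ k < n, Nonempty (FreeGroup (α (k + 1)) ≃* (p k).ker))
    -- which is countable of cardinality at least two
    (hcountable : ∀ k < n, Countable (α (k + 1)))
    (hcard : ∀ k < n, 2 ≤ Cardinal.mk (α (k + 1)))
    -- the projections are split epimorphisms
    (hsplit : ∀ k < n, ∃ s : Γ k →* Γ (k + 1), (p k).comp s = MonoidHom.id (Γ k))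
    -- `Γ k` acts trivially on the homology of the kernel of `Γ (k + 1) → Γ k`
    (htriv : ∀ k < n, ActsTriviallyOnKernelHomology (p k)) :
    IsAddCyclic (LieAlgebra.center ℤ (DescendingCentralSeries.Gr (Γ n))) ∧
      ((∀ k ≤ n, 2 ≤ Cardinal.mk (α k)) →
        LieAlgebra.center ℤ (DescendingCentralSeries.Gr (Γ n)) = ⊥ ∧
          Subgroup.center (Γ n) = ⊥) := by
  suffices H : ∀ k ≤ n, IsAddCyclic (LieAlgebra.center ℤ (Gr (Γ k))) ∧
      (2 ≤ Cardinal.mk (α 0) →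
        LieAlgebra.center ℤ (Gr (Γ k)) = ⊥ ∧ Subgroup.center (Γ k) = ⊥) from
    ⟨(H n le_rfl).1, fun h => (H n le_rfl).2 (h 0 n.zero_le)⟩
  intro k
  induction k with
  | zero =>
    intro _
    obtain ⟨e⟩ := hzero
    have hfree : 2 ≤ Cardinal.mk (α 0) →
        LieAlgebra.center ℤ (Gr (Γ 0)) = ⊥ ∧ Subgroup.center (Γ 0) = ⊥ := fun h => by
      obtain ⟨a, b, hab⟩ := Cardinal.two_le_iff.1 h
      exact centers_eq_bot_of_free hab e
    refine ⟨?_, hfree⟩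
    by_cases h : 2 ≤ Cardinal.mk (α 0)
    · rw [(hfree h).1]
      infer_instance
    · have : Subsingleton (α 0) := ⟨fun a b => by
        by_contra hab
        exact h (Cardinal.two_le_iff.2 ⟨a, b, hab⟩)⟩
      have := FreeGroup.isCyclic_of_subsingleton (α 0)
      have := isCyclic_of_surjective e.toMonoidHom e.surjective
      have := isAddCyclic_gr_of_isCyclic (G := Γ 0)
      exact isAddCyclic_of_injective
        (LieAlgebra.center ℤ (Gr (Γ 0))).toSubmodule.toAddSubgroup.subtype Subtype.val_injective
  | succ k ih =>
    intro hk
    obtain ⟨hcyc, hbot⟩ := ih (by omega)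
    obtain ⟨e⟩ := hker k hk
    obtain ⟨a, b, hab⟩ := Cardinal.two_le_iff.1 (hcard k hk)
    obtain ⟨s, hs⟩ := hsplit k hk
    have h := (htriv k hk).commutator_ker_top_le
    exact ⟨isAddCyclic_center_gr hs h hab e hcyc, fun h0 =>
      ⟨center_gr_eq_bot hs h hab e (hbot h0).1, center_eq_bot_of_free_ker hs hab e (hbot h0).2⟩⟩
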